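/- Let $d\ge 1$, let $\Omega\subset\mathbb R^d$ be a bounded open set with a conforming partition $\mathcal T^H=\{K_1,\dots,K_N\}$ into nondegenerate finite elements (images of the unit cube under the multilinear, or of the unit simplex under the affine, map determined by their vertices $x_1,\dots,x_{N_c}$), and let $H=\max_i\operatorname{diam}K_i$. Let $\kappa$ be measurable with $0<\kappa_0\le\kappa\le\kappa_1$ a.e. in $\Omega$, $f\in L^2(\Omega)$, $V=H^1_0(\Omega)$, $a(v,w)=\int_\Omega\kappa\nabla v\cdot\nabla w$ and $\|v\|_a=a(v,v)^{1/2}$. Let $\{\chi_j\}_{j=1}^{N_c}$ be either the multiscale partition of unity (on each $K_i$, $-\operatorname{div}(\kappa\nabla\chi_j)=0$ weakly, with boundary values on $\partial K_i$ those of the (bi)linear nodal basis function of $x_j$) or the (bi)linear partition of unity (the nodal basis functions themselves: multilinear on cube-type elements, affine on simplices). Put $\tilde\kappa=\sum_{j}\kappa|\nabla\chi_j|^2$, $a_i(v,w)=\int_{K_i}\kappa\nabla v\cdot\nabla w$, $s_i(v,w)=\int_{K_i}\tilde\kappa vw$, $s=\sum_i s_i$, and let $V(K_i)$ be the set of restrictions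 to $K_i$ of elements of $V$. For each $i$ let $\lambda^{(i)}_1\le\lambda^{(i)}_2\le\cdots$ with $\phi^{(i)}_1,\phi^{(i)}_2,\dots\in V(K_i)$ be the eigenpairs, in ascending order and with multiplicity, of $$a_i(\phi,w)=\lambda\, s_i(\phi,w)\qquad\forall w\in V(K_i),$$ the $\phi^{(i)}_j$ being pairwise $s_i$-orthogonal with $s_i(\phi^{(i)}_j,\phi^{(i)}_j)>0$ and forming a complete system in $V(K_i)$ with respect to the norm $s_i(v,v)^{1/2}$. Fix integers $l_i\ge 0$, extend the $\phi_j^{(i)}$ by zero outside $K_i$, and set, for $v\in V$, $$\pi(v)=\sum_{i=1}^N\sum_{j=1}^{l_i}\frac{s_i(v,\phi^{(i)}_j)}{s_i(\phi^{(i)}_j,\phi^{(i)}_j)}\phi^{(i)}_j,\qquad \tilde V=\{v\in V:\pi(v)=0\},\qquad \Lambda=\min_{1\le i\le N}\lambda^{(i)}_{l_i+1}.$$ For $1\le i\le N$, $1\le j\le l_i$, let $\psi^{(i)}_j$ be a minimizer of $a(\psi,\psi)$ over all $\psi\in V$ with $s(\psi,\phi^{(i)}_j)=1$ and $s(\psi,\phi^{(i')}_{j'})=0$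 for all $(i',j')\neq(i,j)$, $1\le j'\le l_{i'}$, and let $V_{glo}$ be the span of the $\psi^{(i)}_j$. Let $u\in V$ satisfy $a(u,v)=\int_\Omega fv$ for all $v\in V$, and let $u_{glo}\in V_{glo}$ satisfy $a(u_{glo},v)=\int_\Omega fv$ for all $v\in V_{glo}$. Then $u-u_{glo}\in\tilde V$ and $$\|u-u_{glo}\|_a\le\Lambda^{-1/2}\,\|\tilde\kappa^{-1/2}f\|_{L^2(\Omega)}.$$ Moreover, if $\{\chi_j\}$ is the (bi)linear partition of unity, then $$\|u-u_{glo}\|_a\le C\,H\,\Lambda^{-1/2}\,\|\kappa^{-1/2}f\|_{L^2(\Omega)}$$ with a constant $C>0$ that depends only on $d$. (The right-hand sides are read in $[0,\infty]$: $\Lambda^{-1/2}=\infty$ if $\Lambda=0$, $\tilde\kappa^{-1/2}|f|=\infty$ where $\tilde\kappa=0\ne f$ and $=0$ where $f=0$, and $\infty\cdot 0=0$.) -/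

import Mathlib

open MeasureTheory Set
open scoped ContDiff ENNReal

noncomputable section

namespace CEM

/-- Euclidean space `ℝ^d`. -/
abbrev E (d : ℕ) : Type := EuclideanSpace ℝ (Fin d)

/-! ### Sobolev spaces -/

/-- Pairs (function, vector field) in `L²(U) × L²(U; ℝ^d)`; a Sobolev function `v` is represented by
the pair `(v, ∇v)`. -/
abbrev Pair {d : ℕ} (U : Set (E d)) : Type :=
  Lp ℝ 2 (volume.restrict U) × Lp (E d) 2 (volume.restrict U)

/-- The function of a pair. -/
abbrev fn {d : ℕ} {U : Set (E d)} (p : Pair U) : E d → ℝ := ⇑p.1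

/-- The gradient of a pair. -/
abbrev gr {d : ℕ} {U : Set (E d)} (p : Pair U) : E d → E d := ⇑p.2

/-- The pairs `(φ, ∇φ)` with `φ ∈ C_c^∞(U)`. -/
def testPairs {d : ℕ} (U : Set (E d)) : Set (Pair U) :=
  {p | ∃ φ : E d → ℝ, ContDiff ℝ ∞ φ ∧ HasCompactSupport φ ∧ tsupport φ ⊆ U ∧
    fn p =ᵐ[volume.restrict U] φ ∧ gr p =ᵐ[volume.restrict U] gradient φ}

/-- `H^1_0(U)`: the closure of `C_c^∞(U)` in the `H^1` norm. -/
def H10 {d : ℕ} (U : Set (E d)) : Submodule ℝ (Pair U) :=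
  (Submodule.span ℝ (testPairs U)).topologicalClosure

/-- `V(K)`: the restrictions to `K` of the elements of `V = H^1_0(Ω)`. -/
def restrictedSpace {d : ℕ} (Ω K : Set (E d)) : Set (Pair K) :=
  {p | ∃ v ∈ H10 Ω, fn v =ᵐ[volume.restrict K] fn p ∧ gr v =ᵐ[volume.restrict K] gr p}

/-! ### Bilinear forms and norms -/

/-- `∫_K κ ∇v · ∇w`, as a function of the gradients. -/
def aForm {d : ℕ} (κ : E d → ℝ) (K : Set (E d)) (g h : E d → E d) : ℝ :=
  ∫ x in K, κ x * inner ℝ (g x) (h x)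

/-- `∫_K w v v'` with weight `w`. -/
def sForm {d : ℕ} (w : E d → ℝ) (K : Set (E d)) (v v' : E d → ℝ) : ℝ :=
  ∫ x in K, w x * v x * v' x

/-- The energy norm `‖v‖_a = (∫_Ω κ |∇v|²)^{1/2}`. -/
def aNorm {d : ℕ} (κ : E d → ℝ) {Ω : Set (E d)} (v : Pair Ω) : ℝ :=
  Real.sqrt (aForm κ Ω (gr v) (gr v))

/-- `‖w^{-1/2} f‖_{L²(Ω)}` in `[0, ∞]` for a weight `w ≥ 0`; the integrand `f² / w` is `∞` where
`w = 0 ≠ f`, and `0` where `f = 0`. -/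
def invWeightNorm {d : ℕ} (w : E d → ℝ) (Ω : Set (E d)) (f : E d → ℝ) : ℝ≥0∞ :=
  (∫⁻ x in Ω, ENNReal.ofReal (f x ^ 2) / ENNReal.ofReal (w x)) ^ (1 / 2 : ℝ)

/-! ### Finite element meshes -/

/-- The two reference elements: the unit cube (quadrilaterals, hexahedra, ...) and the unit
simplex (triangles, tetrahedra, ...). -/
inductive Ref : Type
  | cube
  | simplex

/-- The vertices of the reference element. -/
abbrev Ref.Idx (d : ℕ) : Ref → Type
  | .cube => Fin d → Bool
  | .simplex => Option (Fin d)

instance Ref.instFintypeIdx (d : ℕ) : (s : Ref) → Fintype (s.Idx d)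
  | .cube => inferInstanceAs (Fintype (Fin d → Bool))
  | .simplex => inferInstanceAs (Fintype (Option (Fin d)))

/-- The open reference element. -/
def Ref.opn (d : ℕ) : Ref → Set (E d)
  | .cube => {t | ∀ k, 0 < t k ∧ t k < 1}
  | .simplex => {t | (∀ k, 0 < t k) ∧ ∑ k, t k < 1}

/-- The closed reference element. -/
def Ref.clo (d : ℕ) : Ref → Set (E d)
  | .cube => {t | ∀ k, 0 ≤ t k ∧ t k ≤ 1}
  | .simplex => {t | (∀ k, 0 ≤ t k) ∧ ∑ k, t k ≤ 1}

/-- The nodal shape functions on the reference element: multilinear on the cube, affine on the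
simplex; each is `1` at its vertex and `0` at the others. -/
def Ref.shape {d : ℕ} : (s : Ref) → s.Idx d → E d → ℝ
  | .cube => fun (ν : Fin d → Bool) t => ∏ k, if ν k then t k else 1 - t k
  | .simplex => fun (ν : Option (Fin d)) t => ν.elim (1 - ∑ k, t k) (fun k => t k)

/-- The (isoparametric) map from the reference element onto the element with vertices `x ν`. -/
def Ref.map {d : ℕ} (s : Ref) (x : s.Idx d → E d) (t : E d) : E d :=
  ∑ ν, s.shape ν t • x ν

/-- A conforming partition of `Ω` into nondegenerate finite elements. -/
structure CoarseMesh {d : ℕ} (Ω : Set (E d)) where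
  /-- the number of vertices -/
  Nc : ℕ
  /-- the number of elements -/
  N : ℕ
  /-- the vertices -/
  vert : Fin Nc → E d
  vert_injective : Function.Injective vert
  /-- the type of each element -/
  kind : Fin N → Ref
  /-- the vertices of each element -/
  conn : (i : Fin N) → (kind i).Idx d → Fin Nc
  injOn : ∀ i, InjOn ((kind i).map fun ν => vert (conn i ν)) ((kind i).clo d)
  nondegenerate : ∀ i, ∀ t ∈ (kind i).clo d,
    (fderiv ℝ ((kind i).map fun ν => vert (conn i ν)) t).det ≠ 0
  subset : ∀ i, ((kind i).map fun ν => vert (conn i ν)) '' (kind i).opn d ⊆ Ω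
  disjoint : Pairwise fun i i' =>
    Disjoint (((kind i).map fun ν => vert (conn i ν)) '' (kind i).opn d)
      (((kind i').map fun ν => vert (conn i' ν)) '' (kind i').opn d)
  cover : closure Ω = ⋃ i, ((kind i).map fun ν => vert (conn i ν)) '' (kind i).clo d
  /-- two distinct closed elements meet exactly in the face spanned by their common vertices,
  i.e. where the shape functions of all other vertices vanish -/
  conforming : ∀ i i', i ≠ i' →
    ((kind i).map fun ν => vert (conn i ν)) '' (kind i).clo d ∩
        ((kind i').map fun ν => vert (conn i' ν)) '' (kind i').clo d =
      ((kind i).map fun ν => vert (conn i ν)) ''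
        {t | t ∈ (kind i).clo d ∧
          ∀ ν, conn i ν ∉ range (conn i') → (kind i).shape ν t = 0}

namespace CoarseMesh

variable {d : ℕ} {Ω : Set (E d)} (T : CoarseMesh Ω)

/-- The element map onto the `i`-th coarse block. -/
def map (i : Fin T.N) : E d → E d := (T.kind i).map fun ν => T.vert (T.conn i ν)

/-- The `i`-th (open) coarse block `K_i`. -/
def K (i : Fin T.N) : Set (E d) := T.map i '' (T.kind i).opn d

/-- The coarse mesh size: the largest diameter of a coarse block. -/
def size : ℝ := ⨆ i, Metric.diam (T.K i)

open Classical in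
/-- The restriction to `K_i` of the (multi)linear nodal basis function of the `j`-th vertex:
the shape function of that vertex, transported to `K_i`, or `0` if it is not a vertex of `K_i`. -/
def nodal (i : Fin T.N) (j : Fin T.Nc) (x : E d) : ℝ :=
  ∑ ν, if T.conn i ν = j then
    (T.kind i).shape ν (Function.invFunOn (T.map i) ((T.kind i).clo d) x) else 0

/-- `χ` is the (bi)linear partition of unity, with (elementwise) gradients `G`. -/
def IsBilinearPU (χ : Fin T.Nc → E d → ℝ) (G : Fin T.Nc → E d → E d) : Prop :=
  ∀ i j, χ j =ᵐ[volume.restrict (T.K i)] T.nodal i j ∧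
    G j =ᵐ[volume.restrict (T.K i)] gradient (T.nodal i j)

/-- `χ` are the multiscale finite element basis functions, with (elementwise) gradients `G`: on each
coarse block `χ_j` is the weak solution of `-div(κ ∇χ_j) = 0` whose boundary values are those of the
(bi)linear nodal basis function, i.e. it differs from the latter by an element of `H^1_0(K_i)`. -/
def IsMultiscalePU (κ : E d → ℝ) (χ : Fin T.Nc → E d → ℝ) (G : Fin T.Nc → E d → E d) : Prop :=
  ∀ i j,
    (∃ w ∈ H10 (T.K i),
      (χ j =ᵐ[volume.restrict (T.K i)] fun x => T.nodal i j x + fn w x) ∧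
      (G j =ᵐ[volume.restrict (T.K i)] fun x => gradient (T.nodal i j) x + gr w x)) ∧
    ∀ z ∈ H10 (T.K i), aForm κ (T.K i) (G j) (gr z) = 0

/-- `s(v, w) = ∑_i s_i(v, w)` for the weight `κt`. -/
def s (κt : E d → ℝ) (v v' : E d → ℝ) : ℝ := ∑ i, sForm κt (T.K i) v v'

/-- A function on `K_i`, extended by zero, as an element of the global auxiliary space. -/
def ext (φ : (i : Fin T.N) → ℕ → Pair (T.K i)) (i : Fin T.N) (n : ℕ) : E d → ℝ :=
  (T.K i).indicator (fn (φ i n))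

/-- The projection `π` onto the auxiliary space, spanned by the first `l i` eigenfunctions of
each coarse block `K_i`. -/
def proj (κt : E d → ℝ) (l : Fin T.N → ℕ) (φ : (i : Fin T.N) → ℕ → Pair (T.K i))
    (v : E d → ℝ) (x : E d) : ℝ :=
  ∑ i, ∑ j : Fin (l i),
    sForm κt (T.K i) v (T.ext φ i j) / sForm κt (T.K i) (T.ext φ i j) (T.ext φ i j) *
      T.ext φ i j x

/-- `Ṽ = {v ∈ V | π(v) = 0}`. -/
def kerProj (κt : E d → ℝ) (l : Fin T.N → ℕ) (φ : (i : Fin T.N) → ℕ → Pair (T.K i)) :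
    Set (H10 Ω) :=
  {v | T.proj κt l φ (fn v.1) =ᵐ[volume.restrict Ω] 0}

open Classical in
/-- The `ψ ∈ V` that are `φ_j^{(i)}`-orthogonal. -/
def orthSet (κt : E d → ℝ) (l : Fin T.N → ℕ) (φ : (i : Fin T.N) → ℕ → Pair (T.K i))
    (p : (i : Fin T.N) × Fin (l i)) : Set (H10 Ω) :=
  {ψ | ∀ q : (i : Fin T.N) × Fin (l i),
    T.s κt (fn ψ.1) (T.ext φ q.1 q.2) = if q = p then 1 else 0}

/-- `ψ` are the global constrained energy minimizing basis functions. -/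
def IsGlobalBasis (κ κt : E d → ℝ) (l : Fin T.N → ℕ)
    (φ : (i : Fin T.N) → ℕ → Pair (T.K i))
    (ψ : ((i : Fin T.N) × Fin (l i)) → H10 Ω) : Prop :=
  ∀ p, ψ p ∈ T.orthSet κt l φ p ∧
    IsMinOn (fun v : H10 Ω => aForm κ Ω (gr v.1) (gr v.1)) (T.orthSet κt l φ p) (ψ p)

end CoarseMesh

/-- The weight `κ̃ = ∑_j κ |∇χ_j|²`. -/
def kappaTilde {d n : ℕ} (κ : E d → ℝ) (G : Fin n → E d → E d) (x : E d) : ℝ :=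
  ∑ j, κ x * ‖G j x‖ ^ 2

/-- `(lam n, φ n)`, `n = 0, 1, …`, is the list, in ascending order and with multiplicity, of the
eigenpairs of the local spectral problem: find `φ ∈ V(K)` and `λ` with
`∫_K κ ∇φ · ∇w = λ ∫_K κt φ w` for all `w ∈ V(K)`. -/
structure IsEigenList {d : ℕ} (κ κt : E d → ℝ) (Ω K : Set (E d)) (lam : ℕ → ℝ)
    (φ : ℕ → Pair K) : Prop where
  mem : ∀ n, φ n ∈ restrictedSpace Ω K
  eigen : ∀ n, ∀ w ∈ restrictedSpace Ω K,
    aForm κ K (gr (φ n)) (gr w) = lam n * sForm κt K (fn (φ n)) (fn w)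
  /-- eigenfunctions are nonzero -/
  pos : ∀ n, 0 < sForm κt K (fn (φ n)) (fn (φ n))
  orth : ∀ m n, m ≠ n → sForm κt K (fn (φ m)) (fn (φ n)) = 0
  mono : Monotone lam
  /-- nothing is left out: the system of eigenfunctions is complete in `V(K)` for the norm
  `(∫_K κt v²)^{1/2}` -/
  complete : ∀ v ∈ restrictedSpace Ω K, ∀ ε > 0, ∃ (n : ℕ) (c : Fin n → ℝ),
    sForm κt K (fn (v - ∑ j, c j • φ j)) (fn (v - ∑ j, c j • φ j)) < ε

end CEM

end

/-! Write e = u - u_glo and L_q(v) = s(v, φ_q) for the constraint functionals, whose common kernel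
is Ṽ. A constrained minimizer ψ_p may be perturbed by any element of Ṽ, so V_glo is a-orthogonal to
Ṽ. The combination z = ∑ L_p(e) ψ_p has the same constraint values as e, hence a(z, e - z) = 0,
while Galerkin orthogonality gives a(z, e) = 0. Thus a(z, z) = 0, z = 0 and e ∈ Ṽ; moreover a(e, e)
= a(u, e) = ∫ f e (`constraint_error_eq_zero`).

On each block e is s_i-orthogonal to the first l_i eigenfunctions, so the min-max bound
`mul_le_of_orthogonal_eigenvectors` applies there, and summation gives Λ s(e, e) ≤ a(e, e). The
weighted Cauchy–Schwarz inequality `ofReal_integral_mul_le` bounds ∫ f e by ‖κ̃^{-1/2} f‖ s(e,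
e)^{1/2}; the two together give the first estimate (`ofReal_sqrt_le_rpow_mul`). For the (bi)linear
partition of unity, differentiating ∑ χ_j = 1 and ∑ χ_j x_j = x yields 1 ≤ 2^d H² ∑ |∇χ_j|²
(`one_le_sum_norm_gradient_nodal`), that is κ ≤ 2^d H² κ̃, and the second estimate follows.

The analytic difficulty is that s must be finite on V: for the multiscale partition of unity κ̃ is a
priori only in L¹, and a Bochner integral that does not converge is 0, which would destroy
bilinearity. The weak maximum principle (`ae_add_le_of_weak_solution`) gives 0 ≤ χ_j ≤ 1; a
Caccioppoli estimate up to the boundary (`integral_sq_mul_sq_le_of_weak_solution`) then bounds ∫ κ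
|∇χ_j|² v² by the H¹ norm for smooth v, and Fatou's lemma carries finiteness to all of V
(`integrable_weight_mul_sq`). -/

namespace CEM

/-! ### Calculus of gradients and L² preliminaries -/

section Gradient

variable {d : ℕ} {f g : E d → ℝ} {x : E d}

lemma gradient_add_of_differentiableAt (hf : DifferentiableAt ℝ f x)
    (hg : DifferentiableAt ℝ g x) :
    gradient (fun y => f y + g y) x = gradient f x + gradient g x := by
  simp only [gradient]
  rw [fderiv_fun_add hf hg, map_add]

lemma gradient_const_mul_of_differentiableAt (c : ℝ) (hf : DifferentiableAt ℝ f x) :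
    gradient (fun y => c * f y) x = c • gradient f x := by
  simp only [gradient]
  rw [fderiv_const_mul hf, map_smul]

lemma gradient_mul_of_differentiableAt (hf : DifferentiableAt ℝ f x)
    (hg : DifferentiableAt ℝ g x) :
    gradient (fun y => f y * g y) x = f x • gradient g x + g x • gradient f x := by
  simp only [gradient]
  rw [fderiv_fun_mul hf hg, map_add, map_smul, map_smul]

lemma gradient_comp_of_differentiableAt {ρ : ℝ → ℝ} (hρ : DifferentiableAt ℝ ρ (f x))
    (hf : DifferentiableAt ℝ f x) :
    gradient (fun y => ρ (f y)) x = deriv ρ (f x) • gradient f x := by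
  have h := (hρ.hasDerivAt.comp_hasFDerivAt x hf.hasFDerivAt).fderiv
  simp only [gradient]
  rw [show (fun y => ρ (f y)) = ρ ∘ f from rfl, h, map_smul]

lemma continuous_gradient (hf : ContDiff ℝ ∞ f) : Continuous (gradient f) :=
  (LinearIsometryEquiv.continuous _).comp (hf.continuous_fderiv (by simp))

lemma hasCompactSupport_gradient (hf : HasCompactSupport f) : HasCompactSupport (gradient f) :=
  (hf.fderiv ℝ).comp_left (g := (InnerProductSpace.toDual ℝ (E d)).symm) (map_zero _)

lemma gradient_eq_zero_of_notMem_tsupport (hx : x ∉ tsupport f) : gradient f x = 0 := by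
  simp only [gradient]
  rw [Function.notMem_support.1 fun h => hx (support_fderiv_subset ℝ h), map_zero]

lemma norm_gradient (f : E d → ℝ) (x : E d) : ‖gradient f x‖ = ‖fderiv ℝ f x‖ := by
  simp [gradient]

end Gradient

section L2

variable {α F : Type*} [MeasurableSpace α] {μ : Measure α} [NormedAddCommGroup F]
  [InnerProductSpace ℝ F]

lemma norm_Lp_two_sq (f : Lp F 2 μ) : ‖f‖ ^ 2 = ∫ x, ‖f x‖ ^ 2 ∂μ := by
  rw [← real_inner_self_eq_norm_sq, L2.inner_def]
  simp only [real_inner_self_eq_norm_sq]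

lemma integrable_inner_of_memLp_two {f g : α → F} (hf : MemLp f 2 μ) (hg : MemLp g 2 μ) :
    Integrable (fun x => (inner ℝ (f x) (g x) : ℝ)) μ := by
  refine (L2.integrable_inner (𝕜 := ℝ) (hf.toLp f) (hg.toLp g)).congr ?_
  filter_upwards [hf.coeFn_toLp, hg.coeFn_toLp] with x h1 h2
  rw [h1, h2]

end L2

/-! ### The space H^1_0 and the Poincaré inequality -/

section Sobolev

variable {d : ℕ} {U : Set (E d)}

lemma memLp_of_continuous_hasCompactSupport {F : Type*} [NormedAddCommGroup F] {g : E d → F}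
    (hg : Continuous g) (hc : HasCompactSupport g) : MemLp g 2 (volume.restrict U) :=
  (hg.memLp_of_hasCompactSupport hc).restrict U

lemma exists_mem_testPairs {φ : E d → ℝ} (hφ : ContDiff ℝ ∞ φ) (hc : HasCompactSupport φ)
    (hU : tsupport φ ⊆ U) :
    ∃ p ∈ testPairs U, fn p =ᵐ[volume.restrict U] φ ∧
      gr p =ᵐ[volume.restrict U] gradient φ := by
  have h1 : MemLp φ 2 (volume.restrict U) :=
    memLp_of_continuous_hasCompactSupport hφ.continuous hc
  have h2 : MemLp (gradient φ) 2 (volume.restrict U) :=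
    memLp_of_continuous_hasCompactSupport (continuous_gradient hφ) (hasCompactSupport_gradient hc)
  exact ⟨(h1.toLp φ, h2.toLp _), ⟨φ, hφ, hc, hU, h1.coeFn_toLp, h2.coeFn_toLp⟩,
    h1.coeFn_toLp, h2.coeFn_toLp⟩

/-- The pairs `(φ, ∇φ)`, `φ ∈ C_c^∞(U)`, form a subspace. -/
def testSubmodule (U : Set (E d)) : Submodule ℝ (Pair U) where
  carrier := testPairs U
  zero_mem' := by
    refine ⟨fun _ => 0, contDiff_const, HasCompactSupport.zero, ?_, Lp.coeFn_zero _ _ _, ?_⟩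
    · rw [show (fun _ : E d => (0 : ℝ)) = 0 from rfl, tsupport_zero]
      exact empty_subset _
    · refine (Lp.coeFn_zero _ _ _).trans (Filter.Eventually.of_forall fun x => ?_)
      simp [gradient]
  add_mem' := by
    rintro p q ⟨φ, hφ, hφc, hφU, hp1, hp2⟩ ⟨η, hη, hηc, hηU, hq1, hq2⟩
    refine ⟨fun x => φ x + η x, hφ.add hη, hφc.add hηc, ?_, ?_, ?_⟩
    · exact (tsupport_add φ η).trans (union_subset hφU hηU)
    · filter_upwards [Lp.coeFn_add p.1 q.1, hp1, hq1] with x h1 h2 h3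
      simp only [fn, Prod.fst_add] at *
      rw [h1, Pi.add_apply, h2, h3]
    · filter_upwards [Lp.coeFn_add p.2 q.2, hp2, hq2] with x h1 h2 h3
      rw [gradient_add_of_differentiableAt (hφ.differentiable (by simp) x)
        (hη.differentiable (by simp) x)]
      simp only [gr, Prod.snd_add] at *
      rw [h1, Pi.add_apply, h2, h3]
  smul_mem' := by
    rintro c p ⟨φ, hφ, hφc, hφU, hp1, hp2⟩
    refine ⟨fun x => c * φ x, contDiff_const.mul hφ, hφc.mul_left, ?_, ?_, ?_⟩
    · exact (tsupport_mul_subset_right).trans hφU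
    · filter_upwards [Lp.coeFn_smul c p.1, hp1] with x h1 h2
      simp only [fn, Prod.smul_fst] at *
      rw [h1, Pi.smul_apply, h2, smul_eq_mul]
    · filter_upwards [Lp.coeFn_smul c p.2, hp2] with x h1 h2
      rw [gradient_const_mul_of_differentiableAt _ (hφ.differentiable (by simp) x)]
      simp only [gr, Prod.smul_snd] at *
      rw [h1, Pi.smul_apply, h2]

/-- The test pairs already form a subspace, so taking the span adds nothing. Closed conditions on
H^1_0 can therefore be checked on test functions alone. -/
lemma H10_eq_closure (U : Set (E d)) : (H10 U : Set (Pair U)) = closure (testPairs U) := by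
  have : Submodule.span ℝ (testPairs U) = testSubmodule U := Submodule.span_eq (testSubmodule U)
  rw [H10, this, Submodule.topologicalClosure_coe]
  rfl

lemma testPairs_subset_H10 {p : Pair U} (hp : p ∈ testPairs U) : p ∈ H10 U := by
  rw [← SetLike.mem_coe, H10_eq_closure]
  exact subset_closure hp

lemma exists_testPair_norm_sub_lt {w : Pair U} (hw : w ∈ H10 U) {ε : ℝ} (hε : 0 < ε) :
    ∃ p ∈ testPairs U, ‖p - w‖ < ε := by
  rw [← SetLike.mem_coe, H10_eq_closure, Metric.mem_closure_iff] at hw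
  obtain ⟨p, hp, h⟩ := hw ε hε
  exact ⟨p, hp, by rwa [← dist_eq_norm, dist_comm]⟩

/-- The Poincaré inequality for test functions. -/
lemma integral_sq_le_of_tsupport_subset (hd : 1 ≤ d) {R : ℝ} (hR : ∀ x ∈ U, ‖x‖ ≤ R)
    {φ : E d → ℝ} (hφ : ContDiff ℝ ∞ φ) (hc : HasCompactSupport φ) (hU : tsupport φ ⊆ U) :
    ∫ x, φ x ^ 2 ≤ (2 * R) ^ 2 * ∫ x, ‖gradient φ x‖ ^ 2 := by
  let e : E d := EuclideanSpace.single ⟨0, hd⟩ 1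
  have he : ‖e‖ = 1 := by simp [e]
  let L : E d →L[ℝ] ℝ := innerSL ℝ e
  have hdiff : ∀ x, DifferentiableAt ℝ φ x := fun x => hφ.differentiable (by simp) x
  have hcf : Continuous (fun x => fderiv ℝ φ x e) :=
    (hφ.continuous_fderiv (by simp)).clm_apply continuous_const
  have hdsq : ∀ x, fderiv ℝ (fun y => φ y ^ 2) x e = 2 * φ x * fderiv ℝ φ x e := fun x => by
    rw [fderiv_fun_pow 2 (hdiff x)]
    simp
  have hsqc : HasCompactSupport (fun x => φ x ^ 2) := hc.comp_left (g := fun t : ℝ => t ^ 2) (by simp)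
  have hLd : ∀ x, fderiv ℝ (fun y => L y) x e = 1 := fun x => by
    rw [show (fun y => L y) = L from rfl, L.fderiv]
    simp [L, he]
  have hcont : Continuous φ := hφ.continuous
  have hcL : Continuous L := L.continuous
  have hi1 : Integrable (fun x => φ x ^ 2) := (hcont.pow 2).integrable_of_hasCompactSupport hsqc
  have hi2 : Integrable (fun x => ‖gradient φ x‖ ^ 2) := by
    have hm : MemLp (gradient φ) 2 volume :=
      (continuous_gradient hφ).memLp_of_hasCompactSupport (hasCompactSupport_gradient hc)
    exact hm.integrable_norm_pow two_ne_zero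
  have hi3 : Integrable (fun x => L x * (2 * φ x * fderiv ℝ φ x e)) := by
    have h0 : HasCompactSupport (fun x => φ x * (2 * L x * fderiv ℝ φ x e)) := hc.mul_right
    have h1 : Continuous (fun x => φ x * (2 * L x * fderiv ℝ φ x e)) := by fun_prop
    have h2 : (fun x => L x * (2 * φ x * fderiv ℝ φ x e)) =
        fun x => φ x * (2 * L x * fderiv ℝ φ x e) := funext fun x => by ring
    rw [h2]
    exact h1.integrable_of_hasCompactSupport h0
  -- Integration by parts against the first coordinate `L`, whose derivative along `e` is 1; `|L| ≤
  -- R` on the support of `φ`.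
  have key : ∫ x, L x * (2 * φ x * fderiv ℝ φ x e) = -∫ x, φ x ^ 2 := by
    have h := integral_mul_fderiv_eq_neg_fderiv_mul_of_integrable
      (μ := (volume : Measure (E d))) (f := fun y => L y) (g := fun y => φ y ^ 2) (v := e)
      (by simpa only [hLd, one_mul] using hi1) (by simpa only [hdsq] using hi3)
      ((hcL.mul (hcont.pow 2)).integrable_of_hasCompactSupport hsqc.mul_left)
      (fun x _ => L.differentiableAt) (fun x _ => (hdiff x).pow 2)
    simpa only [hLd, hdsq, one_mul] using h
  -- Young's inequality with weight 1/2, so that half of ∫ φ² is absorbed on the left; doubling 2R²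
  -- then gives (2R)².
  have hle : ∫ x, φ x ^ 2 ≤ ∫ x, (1 / 2 * φ x ^ 2 + 2 * R ^ 2 * ‖gradient φ x‖ ^ 2) := by
    have h1 : ∫ x, φ x ^ 2 = ∫ x, -(L x * (2 * φ x * fderiv ℝ φ x e)) := by
      rw [integral_neg, key, neg_neg]
    rw [h1]
    refine integral_mono hi3.neg ((hi1.const_mul _).add (hi2.const_mul _)) fun x => ?_
    change -(L x * (2 * φ x * fderiv ℝ φ x e)) ≤
      1 / 2 * φ x ^ 2 + 2 * R ^ 2 * ‖gradient φ x‖ ^ 2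
    by_cases hx : x ∈ tsupport φ
    · have hLx : L x ^ 2 ≤ R ^ 2 := by
        have : |L x| ≤ ‖e‖ * ‖x‖ := abs_real_inner_le_norm e x
        rw [he, one_mul] at this
        exact sq_le_sq' (by linarith [neg_abs_le (L x), hR x (hU hx)])
          (by linarith [le_abs_self (L x), hR x (hU hx)])
      have hDx : fderiv ℝ φ x e ^ 2 ≤ ‖gradient φ x‖ ^ 2 := by
        rw [norm_gradient, ← sq_abs (fderiv ℝ φ x e)]
        gcongr
        simpa [he] using (fderiv ℝ φ x).le_opNorm e
      have h2 : L x ^ 2 * fderiv ℝ φ x e ^ 2 ≤ R ^ 2 * ‖gradient φ x‖ ^ 2 := by gcongr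
      nlinarith [sq_nonneg (φ x + 2 * (L x * fderiv ℝ φ x e))]
    · rw [image_eq_zero_of_notMem_tsupport hx]
      simp only [mul_zero, zero_mul, neg_zero]
      positivity
  rw [integral_add (hi1.const_mul _) (hi2.const_mul _), integral_const_mul,
    integral_const_mul] at hle
  linarith

/-- The Poincaré inequality on `H^1_0(U)`. -/
lemma norm_fst_le_of_mem_H10 (hd : 1 ≤ d) {R : ℝ} (hR0 : 0 ≤ R) (hR : ∀ x ∈ U, ‖x‖ ≤ R)
    {p : Pair U} (hp : p ∈ H10 U) : ‖p.1‖ ≤ 2 * R * ‖p.2‖ := by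
  rw [← SetLike.mem_coe, H10_eq_closure] at hp
  refine closure_minimal (t := {p : Pair U | ‖p.1‖ ≤ 2 * R * ‖p.2‖}) ?_
    (isClosed_le (by fun_prop) (by fun_prop)) hp
  rintro q ⟨φ, hφ, hc, hU, h1, h2⟩
  refine (sq_le_sq₀ (norm_nonneg _) (by positivity)).1 ?_
  rw [mul_pow, norm_Lp_two_sq, norm_Lp_two_sq]
  have e1 : ∫ x in U, ‖q.1 x‖ ^ 2 = ∫ x, φ x ^ 2 := by
    rw [integral_congr_ae (g := fun x => φ x ^ 2)]
    · refine setIntegral_eq_integral_of_forall_compl_eq_zero fun x hx => ?_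
      rw [image_eq_zero_of_notMem_tsupport fun h => hx (hU h)]; simp
    · filter_upwards [h1] with x (hx : q.1 x = _)
      rw [hx, Real.norm_eq_abs, sq_abs]
  have e2 : ∫ x in U, ‖q.2 x‖ ^ 2 = ∫ x, ‖gradient φ x‖ ^ 2 := by
    rw [integral_congr_ae (g := fun x => ‖gradient φ x‖ ^ 2)]
    · refine setIntegral_eq_integral_of_forall_compl_eq_zero fun x hx => ?_
      rw [gradient_eq_zero_of_notMem_tsupport fun h => hx (hU h)]; simp
    · filter_upwards [h2] with x (hx : q.2 x = _)
      rw [hx]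
  rw [e1, e2]
  exact integral_sq_le_of_tsupport_subset hd hR hφ hc hU

end Sobolev

end CEM

/-! ### Linear algebra: the min-max bound and constrained minimizers -/

namespace CEM

section Abstract

variable {V : Type*} [AddCommGroup V] [Module ℝ V]

/-- The min-max bound: a vector that is `s`-orthogonal to the first `l` eigenvectors of the pencil
`(a, s)` has Rayleigh quotient at least the next eigenvalue. -/
lemma mul_le_of_orthogonal_eigenvectors (a s : V →ₗ[ℝ] V →ₗ[ℝ] ℝ)
    (ha : ∀ v w, a v w = a w v) (hs : ∀ v w, s v w = s w v)
    (ha0 : ∀ v, 0 ≤ a v v) (hs0 : ∀ v, 0 ≤ s v v) (lam : ℕ → ℝ) (φ : ℕ → V)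
    (eigen : ∀ n w, a (φ n) w = lam n * s (φ n) w) (pos : ∀ n, 0 < s (φ n) (φ n))
    (orth : ∀ m n, m ≠ n → s (φ m) (φ n) = 0) (mono : Monotone lam)
    (complete : ∀ v, ∀ ε > 0, ∃ (n : ℕ) (c : Fin n → ℝ),
      s (v - ∑ j, c j • φ j) (v - ∑ j, c j • φ j) < ε)
    (l : ℕ) (v : V) (hv : ∀ j < l, s v (φ j) = 0) : lam l * s v v ≤ a v v := by
  have hlam : ∀ n, 0 ≤ lam n := fun n => by
    have h := ha0 (φ n)
    rw [eigen] at h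
    exact nonneg_of_mul_nonneg_left h (pos n)
  -- Completeness holds only in the s-norm, so the energy of the remainder `q` is not small; only `a
  -- q q ≥ 0` is needed. With the Fourier coefficients `b`, `q` is s-orthogonal to the eigenvectors
  -- in `comb b`, hence also a-orthogonal to them by the eigenvalue equation.
  have hε : ∀ ε > 0, lam l * s v v ≤ a v v + lam l * ε := by
    intro ε hε
    obtain ⟨n, c, hc⟩ := complete v ε hε
    let b : Fin n → ℝ := fun j => s v (φ j) / s (φ j) (φ j)
    let comb : (Fin n → ℝ) → V := fun c => ∑ j, c j • φ j
    have hcomb : ∀ (c : Fin n → ℝ) (k : Fin n), s (φ k) (comb c) = c k * s (φ k) (φ k) := by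
      intro c k
      simp only [comb, map_sum, map_smul, smul_eq_mul]
      rw [Finset.sum_eq_single k]
      · intro j _ hj
        rw [orth k j (fun h => hj (Fin.ext h.symm)), mul_zero]
      · simp
    have hcc : ∀ (c : Fin n → ℝ) (w : V), s (comb c) w = ∑ j, c j * s (φ j) w := by
      intro c w
      simp [comb, LinearMap.sum_apply]
    have hac : ∀ (c : Fin n → ℝ) (w : V), a (comb c) w = ∑ j, c j * (lam j * s (φ j) w) := by
      intro c w
      simp [comb, LinearMap.sum_apply, eigen]
    set q := v - comb b with hq
    have hφq : ∀ k : Fin n, s (φ k) q = 0 := by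
      intro k
      rw [hq, map_sub, hcomb, hs]
      simp only [b]
      rw [div_mul_cancel₀ _ (pos k).ne', sub_self]
    -- The Fourier sum is the best s-approximation, so it does at least as well as the given `c`.
    have hsq : s q q < ε := by
      have hdec : v - comb c = q + comb (b - c) := by
        simp only [hq, comb, Pi.sub_apply, sub_smul, Finset.sum_sub_distrib]
        abel
      have h0 : s (comb (b - c)) q = 0 := by
        rw [hcc]
        simp [hφq]
      have h1 : s (v - comb c) (v - comb c) = s q q + s (comb (b - c)) (comb (b - c)) := by
        rw [hdec]
        simp only [map_add, LinearMap.add_apply]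
        rw [h0, hs q (comb (b - c)), h0]
        ring
      have h2 := hs0 (comb (b - c))
      have h3 : s (v - comb c) (v - comb c) < ε := hc
      linarith
    have hv' : v = q + comb b := by simp [hq]
    have hsv : s v v = s q q + s (comb b) (comb b) := by
      have h0 : s (comb b) q = 0 := by
        rw [hcc]
        simp [hφq]
      conv_lhs => rw [hv']
      simp only [map_add, LinearMap.add_apply]
      rw [h0, hs q (comb b), h0]
      ring
    have hav : a v v = a q q + a (comb b) (comb b) := by
      have h0 : a (comb b) q = 0 := by
        rw [hac]
        simp [hφq]
      conv_lhs => rw [hv']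
      simp only [map_add, LinearMap.add_apply]
      rw [h0, ha q (comb b), h0]
      ring
    -- Both sides are diagonal in the eigenvectors: coefficients below `l` vanish by `hv`, and the
    -- others carry eigenvalues at least `lam l`.
    have hP : lam l * s (comb b) (comb b) ≤ a (comb b) (comb b) := by
      rw [hcc, hac, Finset.mul_sum]
      refine Finset.sum_le_sum fun j _ => ?_
      rw [hcomb]
      by_cases hj : (j : ℕ) < l
      · simp [b, hv j hj]
      · have h1 := mono (not_lt.1 hj)
        have h2 : 0 ≤ b j * (b j * s (φ j) (φ j)) := by
          rw [← mul_assoc]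
          exact mul_nonneg (mul_self_nonneg _) (pos j).le
        calc lam l * (b j * (b j * s (φ j) (φ j))) ≤ lam j * (b j * (b j * s (φ j) (φ j))) := by
              gcongr
          _ = _ := by ring
    have h1 := ha0 q
    have h2 : lam l * s q q ≤ lam l * ε := mul_le_mul_of_nonneg_left hsq.le (hlam l)
    rw [hsv, hav, mul_add]
    linarith
  refine le_of_forall_pos_le_add fun δ hδ => ?_
  have h1 : 0 < lam l + 1 := by linarith [hlam l]
  have h2 := hε (δ / (lam l + 1)) (by positivity)
  have h3 : lam l * (δ / (lam l + 1)) ≤ δ := by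
    rw [← mul_div_assoc, div_le_iff₀ h1]
    nlinarith
  linarith

/-- The error of the Galerkin solution in the span of constrained energy minimizers lies in the
kernel of the constraints. -/
lemma constraint_error_eq_zero {ι : Type*} [Fintype ι] [DecidableEq ι] (a : V →ₗ[ℝ] V →ₗ[ℝ] ℝ)
    (ha : ∀ v w, a v w = a w v) (ha1 : ∀ v, a v v = 0 → v = 0)
    (L : ι → V →ₗ[ℝ] ℝ) (ψ : ι → V) (hψ : ∀ p q, L q (ψ p) = if q = p then 1 else 0)
    (hmin : ∀ p v, (∀ q, L q v = if q = p then 1 else 0) → a (ψ p) (ψ p) ≤ a v v)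
    (F : V → ℝ) (u ug : V) (hu : ∀ v, a u v = F v) (hug : ug ∈ Submodule.span ℝ (range ψ))
    (hgal : ∀ v ∈ Submodule.span ℝ (range ψ), a ug v = F v) :
    (∀ q, L q (u - ug) = 0) ∧ a (u - ug) (u - ug) = F (u - ug) := by
  have horth : ∀ p w, (∀ q, L q w = 0) → a (ψ p) w = 0 := by
    intro p w hw
    -- Since `ψ p + t • w` satisfies the same constraints, minimality makes this quadratic
    -- nonnegative; it has no constant term, so its discriminant forces the linear coefficient to
    -- vanish.
    have h : ∀ t : ℝ, 0 ≤ a w w * (t * t) + 2 * a (ψ p) w * t + 0 := by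
      intro t
      have h1 := hmin p (ψ p + t • w) fun q => by simp [hψ, hw]
      simp only [map_add, LinearMap.add_apply, map_smul, LinearMap.smul_apply, smul_eq_mul] at h1
      rw [ha w (ψ p)] at h1
      linarith
    have h2 := discrim_le_zero h
    rw [discrim] at h2
    nlinarith [sq_nonneg (a (ψ p) w)]
  have horth' : ∀ z ∈ Submodule.span ℝ (range ψ), ∀ w, (∀ q, L q w = 0) → a z w = 0 := by
    intro z hz w hw
    induction hz using Submodule.span_induction with
    | mem x hx =>
      obtain ⟨p, rfl⟩ := hx
      exact horth p w hw
    | zero => simp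
    | add x y _ _ hx hy => rw [map_add, LinearMap.add_apply, hx, hy, add_zero]
    | smul c x _ hx => rw [map_smul, LinearMap.smul_apply, hx, smul_zero]
  have hgal0 : ∀ z ∈ Submodule.span ℝ (range ψ), a (u - ug) z = 0 := by
    intro z hz
    rw [map_sub, LinearMap.sub_apply, hu, hgal z hz, sub_self]
  set e := u - ug with he
  let z : V := ∑ p, L p e • ψ p
  have hz : z ∈ Submodule.span ℝ (range ψ) :=
    Submodule.sum_mem _ fun p _ => Submodule.smul_mem _ _ (Submodule.subset_span ⟨p, rfl⟩)
  have hLz : ∀ q, L q z = L q e := by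
    intro q
    simp [z, hψ]
  have hez : ∀ q, L q (e - z) = 0 := fun q => by rw [map_sub, hLz, sub_self]
  -- a(z, z) = a(z, e) - a(z, e - z), where the first term vanishes by Galerkin orthogonality and
  -- the second because `e - z` satisfies the homogeneous constraints.
  have hz0 : z = 0 := by
    refine ha1 z ?_
    have h1 := horth' z hz _ hez
    rw [map_sub, ha z e, hgal0 z hz] at h1
    linarith
  have hLe : ∀ q, L q e = 0 := fun q => by rw [← hLz, hz0, map_zero]
  refine ⟨hLe, ?_⟩
  rw [← hu e, he, map_sub a u ug, LinearMap.sub_apply, ← he, horth' ug hug e hLe, sub_zero]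

end Abstract

end CEM

/-! ### Geometry of the reference elements -/

namespace CEM

namespace Ref

variable {d : ℕ}

lemma contDiff_coord (k : Fin d) : ContDiff ℝ ∞ (fun t : E d => t k) :=
  (EuclideanSpace.proj k : E d →L[ℝ] ℝ).contDiff

lemma continuous_coord (k : Fin d) : Continuous (fun t : E d => t k) :=
  (contDiff_coord k).continuous

lemma contDiff_shape (s : Ref) (ν : s.Idx d) : ContDiff ℝ ∞ (s.shape ν) := by
  cases s with
  | cube =>
    refine contDiff_prod fun k _ => ?_
    by_cases h : (show Fin d → Bool from ν) k
    · simpa [h] using contDiff_coord k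
    · simpa [h] using contDiff_const.sub (contDiff_coord k)
  | simplex =>
    match ν with
    | none => exact contDiff_const.sub (ContDiff.sum fun k _ => contDiff_coord k)
    | some k => exact contDiff_coord k

lemma sum_shape (s : Ref) (t : E d) : ∑ ν : s.Idx d, s.shape ν t = 1 := by
  cases s with
  | cube =>
    -- Expand the product ∏ (t_k + (1 - t_k)) = 1.
    have h := Finset.prod_univ_sum (fun _ : Fin d => (Finset.univ : Finset Bool))
      (fun k b => if b then t k else 1 - t k)
    rw [Fintype.piFinset_univ] at h
    refine Eq.trans h.symm ?_
    simp
  | simplex =>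
    change ∑ ν : Option (Fin d), ν.elim (1 - ∑ k, t k) (fun k => t k) = 1
    rw [Fintype.sum_option]
    simp

lemma shape_nonneg (s : Ref) (ν : s.Idx d) {t : E d} (ht : t ∈ s.clo d) : 0 ≤ s.shape ν t := by
  cases s with
  | cube =>
    refine Finset.prod_nonneg fun k _ => ?_
    split_ifs
    · exact (ht k).1
    · linarith [(ht k).2]
  | simplex =>
    match ν with
    | none => exact sub_nonneg.2 ht.2
    | some k => exact ht.1 k

/-- The source of the factor 2^d in the final constant; for the simplex, d + 1 ≤ 2^d. -/
lemma card_idx_le (s : Ref) : Fintype.card (s.Idx d) ≤ 2 ^ d := by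
  cases s with
  | cube =>
    refine le_of_eq ?_
    change Fintype.card (Fin d → Bool) = 2 ^ d
    simp
  | simplex =>
    change Fintype.card (Option (Fin d)) ≤ 2 ^ d
    rw [Fintype.card_option, Fintype.card_fin]
    exact Nat.lt_two_pow_self

lemma opn_subset_clo (s : Ref) : s.opn d ⊆ s.clo d := by
  cases s with
  | cube => exact fun t ht k => ⟨(ht k).1.le, (ht k).2.le⟩
  | simplex => exact fun t ht => ⟨fun k => (ht.1 k).le, ht.2.le⟩

lemma isOpen_opn (s : Ref) : IsOpen (s.opn d) := by
  cases s with
  | cube =>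
    have : (Ref.cube.opn d) = ⋂ k, {t : E d | 0 < t k ∧ t k < 1} := by
      ext t; simp [opn]
    rw [this]
    exact isOpen_iInter_of_finite fun k => (isOpen_lt continuous_const (continuous_coord k)).inter
      (isOpen_lt (continuous_coord k) continuous_const)
  | simplex =>
    have : (Ref.simplex.opn d) = (⋂ k, {t : E d | 0 < t k}) ∩ {t : E d | ∑ k, t k < 1} := by
      ext t; simp [opn]
    rw [this]
    exact (isOpen_iInter_of_finite fun k => isOpen_lt continuous_const (continuous_coord k)).inter
      (isOpen_lt (continuous_finsetSum _ fun k _ => continuous_coord k) continuous_const)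

lemma isClosed_clo (s : Ref) : IsClosed (s.clo d) := by
  cases s with
  | cube =>
    have : (Ref.cube.clo d) = ⋂ k, {t : E d | 0 ≤ t k ∧ t k ≤ 1} := by
      ext t; simp [clo]
    rw [this]
    exact isClosed_iInter fun k => (isClosed_le continuous_const (continuous_coord k)).inter
      (isClosed_le (continuous_coord k) continuous_const)
  | simplex =>
    have : (Ref.simplex.clo d) = (⋂ k, {t : E d | 0 ≤ t k}) ∩ {t : E d | ∑ k, t k ≤ 1} := by
      ext t; simp [clo]
    rw [this]
    exact (isClosed_iInter fun k => isClosed_le continuous_const (continuous_coord k)).inter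
      (isClosed_le (continuous_finsetSum _ fun k _ => continuous_coord k) continuous_const)

lemma coord_mem_Icc (s : Ref) {t : E d} (ht : t ∈ s.clo d) (k : Fin d) : t k ∈ Icc (0 : ℝ) 1 := by
  cases s with
  | cube => exact ht k
  | simplex =>
    exact ⟨ht.1 k, (Finset.single_le_sum (fun i _ => ht.1 i) (Finset.mem_univ k)).trans ht.2⟩

lemma isCompact_clo (s : Ref) : IsCompact (s.clo d) := by
  refine Metric.isCompact_of_isClosed_isBounded s.isClosed_clo ?_
  refine Metric.isBounded_iff_subset_closedBall 0 |>.2 ⟨Real.sqrt d, fun t ht => ?_⟩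
  rw [mem_closedBall_zero_iff, EuclideanSpace.norm_eq]
  refine Real.sqrt_le_sqrt ?_
  calc ∑ k, ‖t k‖ ^ 2 ≤ ∑ _k : Fin d, (1 : ℝ) := by
        refine Finset.sum_le_sum fun k _ => ?_
        have h := s.coord_mem_Icc ht k
        rw [Real.norm_eq_abs, sq_abs]
        nlinarith [h.1, h.2]
    _ = d := by simp

/-- A point of the open reference element. -/
noncomputable def center (d : ℕ) : E d := WithLp.toLp 2 fun _ => 1 / ((d : ℝ) + 1)

/-- Moving towards an interior point makes all inequalities strict. The coordinate 1/(d+1) serves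
both element types: it lies in (0, 1) because d ≥ 1, and d copies of it sum to less than 1. -/
lemma segment_mem_opn (hd : 1 ≤ d) (s : Ref) {t : E d} (ht : t ∈ s.clo d) {ε : ℝ} (h0 : 0 < ε)
    (h1 : ε < 1) : (1 - ε) • t + ε • center d ∈ s.opn d := by
  have hd' : (1 : ℝ) ≤ d := by exact_mod_cast hd
  have hc0 : 0 < 1 / ((d : ℝ) + 1) := by positivity
  have hc1 : 1 / ((d : ℝ) + 1) < 1 := by
    rw [div_lt_one (by positivity)]
    linarith
  have hcoord : ∀ k, ((1 - ε) • t + ε • center d) k = (1 - ε) * t k + ε * (1 / ((d : ℝ) + 1)) :=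
    fun k => by simp [center]
  have hpos : ∀ k, 0 < ((1 - ε) • t + ε • center d) k := fun k => by
    rw [hcoord]
    have := mul_nonneg (sub_nonneg.2 h1.le) (s.coord_mem_Icc ht k).1
    have := mul_pos h0 hc0
    linarith
  cases s with
  | cube =>
    refine fun k => ⟨hpos k, ?_⟩
    rw [hcoord]
    have := mul_le_mul_of_nonneg_left (ht k).2 (sub_nonneg.2 h1.le)
    have := mul_lt_mul_of_pos_left hc1 h0
    linarith
  | simplex =>
    refine ⟨hpos, ?_⟩
    simp only [hcoord, Finset.sum_add_distrib, ← Finset.mul_sum]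
    have h2 := mul_le_mul_of_nonneg_left ht.2 (sub_nonneg.2 h1.le)
    have h3 : ∑ _k : Fin d, 1 / ((d : ℝ) + 1) < 1 := by
      rw [Finset.sum_const, Finset.card_univ, Fintype.card_fin, nsmul_eq_mul, mul_one_div,
        div_lt_one (by positivity)]
      linarith
    have := mul_lt_mul_of_pos_left h3 h0
    linarith

lemma clo_subset_closure_opn (hd : 1 ≤ d) (s : Ref) : s.clo d ⊆ closure (s.opn d) := by
  intro t ht
  have hlim : Filter.Tendsto (fun ε : ℝ => (1 - ε) • t + ε • center d)
      (nhdsWithin 0 (Ioi 0)) (nhds t) := by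
    have : Continuous (fun ε : ℝ => (1 - ε) • t + ε • center d) := by fun_prop
    have h := (this.tendsto 0).mono_left (nhdsWithin_le_nhds (s := Ioi (0 : ℝ)))
    simpa using h
  refine mem_closure_of_tendsto hlim ?_
  filter_upwards [Ioo_mem_nhdsGT (zero_lt_one : (0 : ℝ) < 1)] with ε hε
  exact s.segment_mem_opn hd ht hε.1 hε.2

lemma convex_opn (s : Ref) : Convex ℝ (s.opn d) := by
  cases s with
  | cube =>
    intro t ht t' ht' a b ha hb hab k
    simp only [PiLp.add_apply, PiLp.smul_apply, smul_eq_mul]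
    exact (convex_Ioo (0 : ℝ) 1) (ht k) (ht' k) ha hb hab
  | simplex =>
    intro t ht t' ht' a b ha hb hab
    refine ⟨fun k => ?_, ?_⟩
    · simp only [PiLp.add_apply, PiLp.smul_apply]
      exact (convex_Ioi (0 : ℝ)) (ht.1 k) (ht'.1 k) ha hb hab
    · simp only [PiLp.add_apply, PiLp.smul_apply, Finset.sum_add_distrib, ← Finset.smul_sum]
      exact (convex_Iio (1 : ℝ)) ht.2 ht'.2 ha hb hab

/-- The difference lies in the frontier of a convex set, which is Lebesgue-null. -/
lemma volume_clo_diff_opn (hd : 1 ≤ d) (s : Ref) : volume (s.clo d \ s.opn d) = 0 := by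
  refine measure_mono_null ?_ (s.convex_opn.addHaar_frontier volume)
  rw [frontier, s.isOpen_opn.interior_eq]
  exact sdiff_subset_sdiff_left (s.clo_subset_closure_opn hd)

/-- The vertices of the reference element. -/
noncomputable def vertex : (s : Ref) → s.Idx d → E d
  | .cube => fun (ν : Fin d → Bool) => WithLp.toLp 2 fun k => if ν k then 1 else 0
  | .simplex => fun (ν : Option (Fin d)) => ν.elim 0 fun k => EuclideanSpace.single k 1

lemma vertex_mem_clo (s : Ref) (ν : s.Idx d) : s.vertex ν ∈ s.clo d := by
  cases s with
  | cube =>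
    intro k
    simp only [vertex]
    split_ifs <;> simp
  | simplex =>
    match ν with
    | none => constructor <;> simp [vertex]
    | some k =>
      constructor
      · intro m
        simp only [vertex, Option.elim, PiLp.single_apply]
        split_ifs <;> simp
      · simp [vertex]

lemma shape_vertex (s : Ref) [DecidableEq (s.Idx d)] (μ ν : s.Idx d) :
    s.shape μ (s.vertex ν) = if μ = ν then 1 else 0 := by
  cases s with
  | cube =>
    change (∏ k, if (show Fin d → Bool from μ) k then
      (if (show Fin d → Bool from ν) k then (1 : ℝ) else 0) else
      1 - (if (show Fin d → Bool from ν) k then (1 : ℝ) else 0)) = _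
    split_ifs with h
    · subst h
      refine Finset.prod_eq_one fun k _ => ?_
      split_ifs <;> simp
    · obtain ⟨k, hk⟩ := Function.ne_iff.1 h
      refine Finset.prod_eq_zero (Finset.mem_univ k) ?_
      revert hk
      cases (show Fin d → Bool from μ) k <;> cases (show Fin d → Bool from ν) k <;> simp
  | simplex =>
    match μ, ν with
    | none, none => simp [shape, vertex]
    | none, some k => simp [shape, vertex]
    | some k, none => simp [shape, vertex]
    | some k, some m => simp [shape, vertex]

lemma map_vertex (s : Ref) (x : s.Idx d → E d) (ν : s.Idx d) : s.map x (s.vertex ν) = x ν := by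
  classical
  simp [map, shape_vertex]

lemma contDiff_map (s : Ref) (x : s.Idx d → E d) : ContDiff ℝ ∞ (s.map x) :=
  ContDiff.sum fun ν _ => (s.contDiff_shape ν).smul contDiff_const

end Ref

end CEM

/-! ### Element maps, nodal basis functions and the covering of Ω -/

namespace CEM

namespace CoarseMesh

variable {d : ℕ} {Ω : Set (E d)} (T : CoarseMesh Ω) (i : Fin T.N)

lemma contDiff_map : ContDiff ℝ ∞ (T.map i) := (T.kind i).contDiff_map _

/-- The inverse of the element map. -/
noncomputable def inv : E d → E d := Function.invFunOn (T.map i) ((T.kind i).clo d)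

lemma inv_map {t : E d} (ht : t ∈ (T.kind i).clo d) : T.inv i (T.map i t) = t :=
  (T.injOn i).leftInvOn_invFunOn ht

lemma inv_mem_opn {x : E d} (hx : x ∈ T.K i) : T.inv i x ∈ (T.kind i).opn d := by
  obtain ⟨t, ht, rfl⟩ := hx
  rwa [T.inv_map i ((T.kind i).opn_subset_clo ht)]

lemma inv_mem_clo {x : E d} (hx : x ∈ T.K i) : T.inv i x ∈ (T.kind i).clo d :=
  (T.kind i).opn_subset_clo (T.inv_mem_opn i hx)

lemma map_inv {x : E d} (hx : x ∈ T.K i) : T.map i (T.inv i x) = x := by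
  obtain ⟨t, ht, rfl⟩ := hx
  rw [T.inv_map i ((T.kind i).opn_subset_clo ht)]

lemma isUnit_fderiv_map {t : E d} (ht : t ∈ (T.kind i).clo d) : IsUnit (fderiv ℝ (T.map i) t) := by
  have h := T.nondegenerate i t ht
  refine ⟨ContinuousLinearEquiv.toUnit
    ((fderiv ℝ (T.map i) t).toContinuousLinearEquivOfDetNeZero h), ?_⟩
  ext x
  rfl

/-- The inverse function theorem gives a smooth local inverse with values in the open reference
element, so nearby points lie in the block; injectivity on the closed element identifies it with the
global inverse. -/
lemma eventually_mem_K_and_contDiffAt_inv {x : E d} (hx : x ∈ T.K i) :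
    (∀ᶠ y in nhds x, y ∈ T.K i) ∧ ContDiffAt ℝ ∞ (T.inv i) x := by
  obtain ⟨t, ht, rfl⟩ := hx
  have htc := (T.kind i).opn_subset_clo ht
  let f' : E d ≃L[ℝ] E d :=
    (fderiv ℝ (T.map i) t).toContinuousLinearEquivOfDetNeZero (T.nondegenerate i t htc)
  have hf : ContDiffAt ℝ ∞ (T.map i) t := (T.contDiff_map i).contDiffAt
  have hf' : HasFDerivAt (T.map i) (f' : E d →L[ℝ] E d) t :=
    (hf.differentiableAt (by simp)).hasFDerivAt
  let g := hf.localInverse hf' (by simp)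
  have hg : ContDiffAt ℝ ∞ g (T.map i t) := hf.to_localInverse hf' (by simp)
  have hgt : g (T.map i t) = t := hf.localInverse_apply_image hf' (by simp)
  have hright : ∀ᶠ y in nhds (T.map i t), T.map i (g y) = y :=
    (hf.hasStrictFDerivAt' hf' (by simp)).eventually_right_inverse
  have hopn : ∀ᶠ y in nhds (T.map i t), g y ∈ (T.kind i).opn d := by
    refine hg.continuousAt.eventually_mem ?_
    rw [hgt]
    exact (T.kind i).isOpen_opn.mem_nhds ht
  refine ⟨?_, hg.congr_of_eventuallyEq ?_⟩
  · filter_upwards [hright, hopn] with y h1 h2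
    exact ⟨g y, h2, h1⟩
  · filter_upwards [hright, hopn] with y h1 h2
    conv_lhs => rw [← h1]
    exact T.inv_map i ((T.kind i).opn_subset_clo h2)

lemma isOpen_K : IsOpen (T.K i) :=
  isOpen_iff_eventually.2 fun _ hx => (T.eventually_mem_K_and_contDiffAt_inv i hx).1

lemma contDiffAt_inv {x : E d} (hx : x ∈ T.K i) : ContDiffAt ℝ ∞ (T.inv i) x :=
  (T.eventually_mem_K_and_contDiffAt_inv i hx).2

lemma fderiv_inv {x : E d} (hx : x ∈ T.K i) :
    fderiv ℝ (T.inv i) x = Ring.inverse (fderiv ℝ (T.map i) (T.inv i x)) := by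
  have hi : HasFDerivAt (T.inv i) (fderiv ℝ (T.inv i) x) x :=
    ((T.contDiffAt_inv i hx).differentiableAt (by simp)).hasFDerivAt
  have hm : HasFDerivAt (T.map i) (fderiv ℝ (T.map i) (T.inv i x)) (T.inv i x) :=
    ((T.contDiff_map i).differentiable (by simp) _).hasFDerivAt
  have h1 : HasFDerivAt (fun y => y) ((fderiv ℝ (T.map i) (T.inv i x)).comp
      (fderiv ℝ (T.inv i) x)) x := by
    refine (hm.comp x hi).congr_of_eventuallyEq ?_
    filter_upwards [(T.isOpen_K i).mem_nhds hx] with y hy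
    exact (T.map_inv i hy).symm
  have h2 : fderiv ℝ (T.map i) (T.inv i x) * fderiv ℝ (T.inv i) x = 1 :=
    h1.unique (hasFDerivAt_id x)
  obtain ⟨A, hA⟩ := T.isUnit_fderiv_map i (T.inv_mem_clo i hx)
  rw [← hA] at h2 ⊢
  rw [Ring.inverse_unit]
  exact (Units.inv_eq_of_mul_eq_one_right h2).symm

/-- Nondegeneracy is assumed on the closed reference element and inversion of operators is
continuous at units, so compactness bounds the derivative uniformly up to the boundary. -/
lemma exists_norm_fderiv_inv_le : ∃ M, 0 ≤ M ∧ ∀ x ∈ T.K i, ‖fderiv ℝ (T.inv i) x‖ ≤ M := by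
  have hcont : ContinuousOn (fun t => Ring.inverse (fderiv ℝ (T.map i) t)) ((T.kind i).clo d) := by
    intro t ht
    obtain ⟨A, hA⟩ := T.isUnit_fderiv_map i ht
    have h1 : ContinuousAt Ring.inverse (fderiv ℝ (T.map i) t) := by
      rw [← hA]
      exact NormedRing.inverse_continuousAt A
    exact (ContinuousAt.comp (f := fderiv ℝ (T.map i)) h1
      ((T.contDiff_map i).continuous_fderiv (by simp)).continuousAt).continuousWithinAt
  obtain ⟨M, hM⟩ := (T.kind i).isCompact_clo.exists_bound_of_continuousOn hcont
  refine ⟨max M 0, le_max_right _ _, fun x hx => ?_⟩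
  rw [T.fderiv_inv i hx]
  exact (hM _ (T.inv_mem_clo i hx)).trans (le_max_left _ _)

lemma nodal_eq (j : Fin T.Nc) : T.nodal i j = fun x => ∑ ν, (open Classical in
    if T.conn i ν = j then (T.kind i).shape ν (T.inv i x) else 0) := rfl

lemma contDiffAt_shape_inv (ν) {x : E d} (hx : x ∈ T.K i) :
    ContDiffAt ℝ ∞ (fun y => (T.kind i).shape ν (T.inv i y)) x :=
  ((T.kind i).contDiff_shape ν).contDiffAt.comp x (T.contDiffAt_inv i hx)

lemma contDiffAt_nodal (j : Fin T.Nc) {x : E d} (hx : x ∈ T.K i) :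
    ContDiffAt ℝ ∞ (T.nodal i j) x := by
  rw [nodal_eq]
  refine ContDiffAt.sum fun ν _ => ?_
  split_ifs
  · exact T.contDiffAt_shape_inv i ν hx
  · exact contDiffAt_const

lemma nodal_nonneg (j : Fin T.Nc) {x : E d} (hx : x ∈ T.K i) : 0 ≤ T.nodal i j x := by
  rw [nodal_eq]
  refine Finset.sum_nonneg fun ν _ => ?_
  split_ifs
  · exact (T.kind i).shape_nonneg ν (T.inv_mem_clo i hx)
  · exact le_rfl

lemma nodal_le_one (j : Fin T.Nc) {x : E d} (hx : x ∈ T.K i) : T.nodal i j x ≤ 1 := by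
  rw [nodal_eq, ← (T.kind i).sum_shape (T.inv i x)]
  refine Finset.sum_le_sum fun ν _ => ?_
  split_ifs
  · exact le_rfl
  · exact (T.kind i).shape_nonneg ν (T.inv_mem_clo i hx)

lemma exists_norm_gradient_nodal_le :
    ∃ M, 0 ≤ M ∧ ∀ j, ∀ x ∈ T.K i, ‖gradient (T.nodal i j) x‖ ≤ M := by
  obtain ⟨M, hM0, hM⟩ := T.exists_norm_fderiv_inv_le i
  have hS : ∀ ν, ∃ S, ∀ t ∈ (T.kind i).clo d, ‖fderiv ℝ ((T.kind i).shape ν) t‖ ≤ S := fun ν =>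
    (T.kind i).isCompact_clo.exists_bound_of_continuousOn
      (((T.kind i).contDiff_shape ν).continuous_fderiv (by simp)).continuousOn
  choose S hS using hS
  have hS0 : ∀ ν, 0 ≤ |S ν| * M := fun ν => by positivity
  refine ⟨∑ ν, |S ν| * M, Finset.sum_nonneg fun ν _ => hS0 ν, fun j x hx => ?_⟩
  rw [norm_gradient, nodal_eq]
  rw [fderiv_fun_sum]
  · refine (norm_sum_le _ _).trans (Finset.sum_le_sum fun ν _ => ?_)
    by_cases h : T.conn i ν = j
    · simp only [h, if_true]
      have h1 : fderiv ℝ (fun y => (T.kind i).shape ν (T.inv i y)) x =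
          (fderiv ℝ ((T.kind i).shape ν) (T.inv i x)).comp (fderiv ℝ (T.inv i) x) :=
        fderiv_comp x (((T.kind i).contDiff_shape ν).differentiable (by simp) _)
          ((T.contDiffAt_inv i hx).differentiableAt (by simp))
      rw [h1]
      refine (ContinuousLinearMap.opNorm_comp_le _ _).trans ?_
      exact mul_le_mul ((hS ν _ (T.inv_mem_clo i hx)).trans (le_abs_self _)) (hM x hx)
        (norm_nonneg _) (abs_nonneg _)
    · simpa [h] using hS0 ν
  · intro ν _
    split_ifs
    · exact (T.contDiffAt_shape_inv i ν hx).differentiableAt (by simp)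
    · exact differentiableAt_const _

/-- The shape functions sum to 1 on all of space, so the value that `inv` takes outside the block is
irrelevant. -/
lemma sum_nodal {x : E d} : ∑ j, T.nodal i j x = 1 := by
  simp only [nodal_eq]
  rw [Finset.sum_comm, ← (T.kind i).sum_shape (T.inv i x)]
  simp

/-- The isoparametric property: element map and nodal functions are built from the same shape
functions. -/
lemma sum_nodal_smul_vert {x : E d} (hx : x ∈ T.K i) : ∑ j, T.nodal i j x • T.vert j = x := by
  simp only [nodal_eq, Finset.sum_smul]
  rw [Finset.sum_comm]
  conv_rhs => rw [← T.map_inv i hx]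
  refine Finset.sum_congr rfl fun ν _ => ?_
  rw [Finset.sum_eq_single (T.conn i ν)] <;> simp +contextual [eq_comm]

lemma isBounded_K : Bornology.IsBounded (T.K i) :=
  (((T.kind i).isCompact_clo.image (T.contDiff_map i).continuous).isBounded).subset
    (image_mono (T.kind i).opn_subset_clo)

lemma vert_mem_closure_K (hd : 1 ≤ d) (ν) : T.vert (T.conn i ν) ∈ closure (T.K i) := by
  have h1 : T.map i ((T.kind i).vertex ν) = T.vert (T.conn i ν) := (T.kind i).map_vertex _ ν
  rw [← h1]
  refine image_closure_subset_closure_image (T.contDiff_map i).continuous ?_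
  exact ⟨_, (T.kind i).clo_subset_closure_opn hd ((T.kind i).vertex_mem_clo ν), rfl⟩

lemma norm_vert_sub_vert_le (hd : 1 ≤ d) (ν ν') :
    ‖T.vert (T.conn i ν) - T.vert (T.conn i ν')‖ ≤ T.size := by
  rw [← dist_eq_norm]
  calc dist (T.vert (T.conn i ν)) (T.vert (T.conn i ν')) ≤ Metric.diam (closure (T.K i)) :=
        Metric.dist_le_diam_of_mem (T.isBounded_K i).closure (T.vert_mem_closure_K i hd ν)
          (T.vert_mem_closure_K i hd ν')
    _ = Metric.diam (T.K i) := Metric.diam_closure _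
    _ ≤ T.size := le_ciSup (f := fun i => Metric.diam (T.K i)) (Set.finite_range _).bddAbove i

/-- The gradients of the nodal basis functions are bounded below by the inverse mesh size. -/
lemma one_le_sum_norm_gradient_nodal (hd : 1 ≤ d) {x : E d} (hx : x ∈ T.K i) :
    1 ≤ 2 ^ d * T.size ^ 2 * ∑ j, ‖gradient (T.nodal i j) x‖ ^ 2 := by
  classical
  have hdiff : ∀ j, DifferentiableAt ℝ (T.nodal i j) x := fun j =>
    (T.contDiffAt_nodal i j hx).differentiableAt (by simp)
  let v : E d := EuclideanSpace.single ⟨0, hd⟩ 1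
  have hv : ‖v‖ = 1 := by simp [v]
  let ν₀ : (T.kind i).Idx d := match T.kind i with
    | .cube => fun _ => false
    | .simplex => none
  let D : Fin T.Nc → ℝ := fun j => fderiv ℝ (T.nodal i j) x v
  have hD : ∀ j, |D j| ≤ ‖gradient (T.nodal i j) x‖ := fun j => by
    rw [norm_gradient]
    simpa [hv] using (fderiv ℝ (T.nodal i j) x).le_opNorm v
  have hsum0 : ∑ j, D j = 0 := by
    have h1 : HasFDerivAt (fun y => ∑ j, T.nodal i j y) (∑ j, fderiv ℝ (T.nodal i j) x) x :=
      HasFDerivAt.fun_sum fun j _ => (hdiff j).hasFDerivAt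
    simp only [sum_nodal] at h1
    have h2 := h1.unique (hasFDerivAt_const 1 x)
    have h3 := congrArg (fun A : E d →L[ℝ] ℝ => A v) h2
    simpa [D, sum_apply] using h3
  have hsumv : ∑ j, D j • T.vert j = v := by
    have h1 : HasFDerivAt (fun y => ∑ j, T.nodal i j y • T.vert j)
        (∑ j, (fderiv ℝ (T.nodal i j) x).smulRight (T.vert j)) x :=
      HasFDerivAt.fun_sum fun j _ => (hdiff j).hasFDerivAt.smul_const _
    have h2 : HasFDerivAt (fun y : E d => y)
        (∑ j, (fderiv ℝ (T.nodal i j) x).smulRight (T.vert j)) x := by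
      refine h1.congr_of_eventuallyEq ?_
      filter_upwards [(T.isOpen_K i).mem_nhds hx] with y hy
      exact (T.sum_nodal_smul_vert i hy).symm
    have h3 := congrArg (fun A : E d →L[ℝ] E d => A v) (h2.unique (hasFDerivAt_id x))
    simpa [D, sum_apply] using h3
  have hDzero : ∀ j ∉ Finset.univ.image (T.conn i), D j = 0 := by
    intro j hj
    have : T.nodal i j = fun _ => 0 := by
      rw [nodal_eq]
      funext y
      refine Finset.sum_eq_zero fun ν _ => ?_
      rw [if_neg]
      rintro rfl
      exact hj (Finset.mem_image_of_mem _ (Finset.mem_univ ν))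
    simp [D, this]
  -- As the `D j` sum to zero, a vertex may be subtracted. Only vertices of this element are kept,
  -- because `T.size` bounds the distances between those only.
  have hkey : v = ∑ j ∈ Finset.univ.image (T.conn i), D j • (T.vert j - T.vert (T.conn i ν₀)) := by
    rw [Finset.sum_subset (Finset.subset_univ _)
      fun j _ hj => by rw [hDzero j hj, zero_smul]]
    simp only [smul_sub, Finset.sum_sub_distrib, ← Finset.sum_smul, hsum0, hsumv, zero_smul,
      sub_zero]
  have hle : 1 ≤ ∑ j ∈ Finset.univ.image (T.conn i), T.size * |D j| := by
    calc (1 : ℝ) = ‖∑ j ∈ Finset.univ.image (T.conn i),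
            D j • (T.vert j - T.vert (T.conn i ν₀))‖ := by rw [← hkey, hv]
      _ ≤ ∑ j ∈ Finset.univ.image (T.conn i), ‖D j • (T.vert j - T.vert (T.conn i ν₀))‖ :=
          norm_sum_le _ _
      _ ≤ _ := by
          refine Finset.sum_le_sum fun j hj => ?_
          obtain ⟨ν, _, rfl⟩ := Finset.mem_image.1 hj
          rw [norm_smul, Real.norm_eq_abs, mul_comm]
          gcongr
          exact T.norm_vert_sub_vert_le i hd ν ν₀
  have hcard : ((Finset.univ.image (T.conn i)).card : ℝ) ≤ 2 ^ d := by
    have h1 : (Finset.univ.image (T.conn i)).card ≤ 2 ^ d :=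
      Finset.card_image_le.trans (T.kind i).card_idx_le
    exact_mod_cast h1
  calc (1 : ℝ) ≤ (∑ j ∈ Finset.univ.image (T.conn i), T.size * |D j|) ^ 2 := one_le_pow₀ hle
    _ ≤ (Finset.univ.image (T.conn i)).card *
        ∑ j ∈ Finset.univ.image (T.conn i), (T.size * |D j|) ^ 2 := sq_sum_le_card_mul_sum_sq
    _ ≤ 2 ^ d * ∑ j, (T.size * ‖gradient (T.nodal i j) x‖) ^ 2 := by
        refine mul_le_mul hcard ?_ (Finset.sum_nonneg fun j _ => sq_nonneg _) (by positivity)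
        refine (Finset.sum_le_sum fun j _ => ?_).trans
          (Finset.sum_le_sum_of_subset_of_nonneg (Finset.subset_univ _) fun j _ _ => sq_nonneg _)
        rw [mul_pow, mul_pow]
        gcongr
        exact hD j
    _ = _ := by
        simp only [mul_pow, ← Finset.mul_sum]
        ring

lemma K_subset : T.K i ⊆ Ω := T.subset i

lemma disjoint_K {i i' : Fin T.N} (h : i ≠ i') : Disjoint (T.K i) (T.K i') := T.disjoint h

lemma isBounded (T : CoarseMesh Ω) : Bornology.IsBounded Ω := by
  refine Bornology.IsBounded.subset ?_ subset_closure
  rw [T.cover]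
  refine (Bornology.isBounded_iUnion).2 fun i => ?_
  exact ((T.kind i).isCompact_clo.image (T.contDiff_map i).continuous).isBounded

/-- The coarse blocks cover `Ω` up to a null set. -/
lemma restrict_eq (T : CoarseMesh Ω) (hd : 1 ≤ d) :
    (volume : Measure (E d)).restrict Ω = volume.restrict (⋃ i, T.K i) := by
  refine Measure.restrict_congr_set ?_
  have hsub : (⋃ i, T.K i) ⊆ Ω := iUnion_subset T.K_subset
  refine Filter.EventuallyEq.symm (ae_eq_set.2 ⟨by simp [sdiff_eq_empty.2 hsub], ?_⟩)
  refine measure_mono_null (t := ⋃ i, T.map i '' ((T.kind i).clo d \ (T.kind i).opn d)) ?_ ?_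
  · rintro x ⟨hx, hxK⟩
    have h1 := subset_closure hx
    rw [T.cover] at h1
    obtain ⟨i, t, ht, rfl⟩ := mem_iUnion.1 h1
    refine mem_iUnion.2 ⟨i, t, ⟨ht, fun h => hxK ?_⟩, rfl⟩
    exact mem_iUnion.2 ⟨i, t, h, rfl⟩
  -- What is missed lies in the images of the null boundaries of the reference elements, and
  -- differentiable maps send null sets to null sets.
  · refine measure_iUnion_null fun i => ?_
    exact addHaar_image_eq_zero_of_differentiableOn_of_addHaar_eq_zero volume
      ((T.contDiff_map i).differentiable (by simp)).differentiableOn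
      ((T.kind i).volume_clo_diff_opn hd)

end CoarseMesh

end CEM

/-! ### The weak maximum principle -/

namespace CEM

lemma memLp_smul_of_ae_bound {α F : Type*} [MeasurableSpace α] {μ : Measure α}
    [NormedAddCommGroup F] [NormedSpace ℝ F] {c : α → ℝ} {g : α → F} {C : ℝ}
    (hc : AEStronglyMeasurable c μ) (hC : ∀ᵐ x ∂μ, |c x| ≤ C) (hg : MemLp g 2 μ) :
    MemLp (fun x => c x • g x) 2 μ := by
  refine hg.of_le_mul (c := C) (hc.smul hg.1) ?_
  filter_upwards [hC] with x hx
  rw [norm_smul, Real.norm_eq_abs]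
  gcongr

lemma exists_bound_deriv_smoothTransition :
    ∃ L, 0 ≤ L ∧ ∀ t, |deriv Real.smoothTransition t| ≤ L := by
  have hcont : Continuous (deriv Real.smoothTransition) :=
    (Real.smoothTransition.contDiff (n := 1)).continuous_deriv le_rfl
  obtain ⟨L, hL⟩ := (isCompact_Icc (a := (0 : ℝ)) (b := 1)).exists_bound_of_continuousOn
    hcont.continuousOn
  refine ⟨max L 0, le_max_right _ _, fun t => ?_⟩
  by_cases ht : t ∈ Icc (0 : ℝ) 1
  · exact (hL t ht).trans (le_max_left _ _)
  · have h0 : deriv Real.smoothTransition t = 0 := by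
      rcases not_and_or.1 ht with h | h
      · have h1 : Real.smoothTransition =ᶠ[nhds t] fun _ => 0 := by
          filter_upwards [Iio_mem_nhds (not_le.1 h)] with s hs
          exact Real.smoothTransition.zero_of_nonpos (le_of_lt hs)
        rw [h1.deriv_eq, deriv_const]
      · have h1 : Real.smoothTransition =ᶠ[nhds t] fun _ => 1 := by
          filter_upwards [Ioi_mem_nhds (not_le.1 h)] with s hs
          exact Real.smoothTransition.one_of_one_le (le_of_lt hs)
        rw [h1.deriv_eq, deriv_const]
    rw [h0, abs_zero]
    exact le_max_right _ _

section Truncation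

variable {d : ℕ} {U : Set (E d)}

/-- A truncation `ρ(g + φ - M)` of a test perturbation of `g ≤ M` is a test function. -/
lemma truncation_contDiff (hU : IsOpen U) {g φ : E d → ℝ} {ρ : ℝ → ℝ} (hρ : ContDiff ℝ ∞ ρ)
    (hρ0 : ∀ t ≤ 0, ρ t = 0) {M : ℝ} (hg : ∀ x ∈ U, ContDiffAt ℝ ∞ g x) (hM : ∀ x ∈ U, g x ≤ M)
    (hφ : ContDiff ℝ ∞ φ) (hφU : tsupport φ ⊆ U) :
    ContDiff ℝ ∞ (U.indicator fun x => ρ (g x + φ x - M)) ∧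
      tsupport (U.indicator fun x => ρ (g x + φ x - M)) ⊆ tsupport φ := by
  have hsupp : tsupport (U.indicator fun x => ρ (g x + φ x - M)) ⊆ tsupport φ := by
    refine closure_mono fun x hx => ?_
    rw [Function.mem_support] at hx ⊢
    intro h0
    refine hx ?_
    by_cases hxU : x ∈ U
    -- Where `φ` vanishes the argument of `ρ` is `g x - M ≤ 0`; this is where the bound on the
    -- boundary values enters.
    · rw [indicator_of_mem hxU, hρ0]
      linarith [hM x hxU]
    · exact indicator_of_notMem hxU _
  refine ⟨contDiff_iff_contDiffAt.2 fun x => ?_, hsupp⟩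
  by_cases hx : x ∈ tsupport (U.indicator fun x => ρ (g x + φ x - M))
  swap
  · exact contDiffAt_const.congr_of_eventuallyEq (notMem_tsupport_iff_eventuallyEq.1 hx)
  have hxU : x ∈ U := hφU (hsupp hx)
  have h1 : ContDiffAt ℝ ∞ (fun x => ρ (g x + φ x - M)) x :=
    hρ.contDiffAt.comp x (((hg x hxU).add hφ.contDiffAt).sub contDiffAt_const)
  refine h1.congr_of_eventuallyEq ?_
  filter_upwards [hU.mem_nhds hxU] with y hy
  exact indicator_of_mem hy _

lemma gradient_truncation (hU : IsOpen U) {g φ : E d → ℝ} {ρ : ℝ → ℝ} (hρ : ContDiff ℝ ∞ ρ)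
    (M : ℝ) (hg : ∀ x ∈ U, ContDiffAt ℝ ∞ g x) (hφ : ContDiff ℝ ∞ φ) {x : E d} (hx : x ∈ U) :
    gradient (U.indicator fun x => ρ (g x + φ x - M)) x =
      deriv ρ (g x + φ x - M) • (gradient g x + gradient φ x) := by
  have hgd : DifferentiableAt ℝ g x := (hg x hx).differentiableAt (by simp)
  have hφd : DifferentiableAt ℝ φ x := hφ.differentiable (by simp) x
  have h1 : (U.indicator fun x => ρ (g x + φ x - M)) =ᶠ[nhds x]
      fun x => ρ (g x + φ x - M) := by
    filter_upwards [hU.mem_nhds hx] with y hy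
    exact indicator_of_mem hy _
  have h2 : DifferentiableAt ℝ (fun y => g y + φ y - M) x := (hgd.add hφd).sub_const M
  rw [h1.gradient_eq, gradient_comp_of_differentiableAt (hρ.differentiable (by simp) _) h2,
    ← gradient_add_of_differentiableAt hgd hφd]
  simp only [gradient]
  rw [fderiv_sub_const]

end Truncation

section WeakSolution

variable {d : ℕ} {U : Set (E d)} {κ : E d → ℝ} {κ₀ κ₁ : ℝ} {g : E d → ℝ} {w : Pair U}

/-- The weak maximum principle for `-div(κ ∇(g + w)) = 0` with boundary values `g`. -/
lemma ae_add_le_of_weak_solution (hd : 1 ≤ d) (hU : IsOpen U) {R : ℝ} (hR0 : 0 ≤ R)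
    (hR : ∀ x ∈ U, ‖x‖ ≤ R) (hκm : AEMeasurable κ (volume.restrict U)) (hκ₀ : 0 < κ₀)
    (hκ₁ : 0 ≤ κ₁)
    (hκ : ∀ᵐ x ∂(volume.restrict U), κ₀ ≤ κ x ∧ κ x ≤ κ₁) {M : ℝ}
    (hg : ∀ x ∈ U, ContDiffAt ℝ ∞ g x) (hgM : ∀ x ∈ U, g x ≤ M)
    (hgrad : MemLp (gradient g) 2 (volume.restrict U)) (hw : w ∈ H10 U)
    (hsol : ∀ z ∈ H10 U, aForm κ U (fun x => gradient g x + gr w x) (gr z) = 0) :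
    ∀ᵐ x ∂(volume.restrict U), g x + fn w x ≤ M := by
  obtain ⟨L, hL0, hL⟩ := exists_bound_deriv_smoothTransition
  set ρ := Real.smoothTransition with hρ
  have hρc : ContDiff ℝ ∞ ρ := Real.smoothTransition.contDiff
  have hρ' : ∀ t, 0 ≤ deriv ρ t := fun t => Real.smoothTransition.monotone.deriv_nonneg
  have hρL : ∀ s t, |ρ s - ρ t| ≤ L * |s - t| := fun s t => by
    have := Convex.norm_image_sub_le_of_norm_deriv_le (f := ρ) (s := univ) (C := L)
      (fun x _ => hρc.differentiable (by simp) x) (fun x _ => hL x) convex_univ (mem_univ t)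
      (mem_univ s)
    simpa only [Real.norm_eq_abs] using this
  have hmeas : MeasurableSet U := hU.measurableSet
  have hfin : volume U < ⊤ :=
    (Metric.isBounded_iff_subset_closedBall (0 : E d) |>.2
      ⟨R, fun x hx => mem_closedBall_zero_iff.2 (hR x hx)⟩).measure_lt_top
  have : IsFiniteMeasure (volume.restrict U) := ⟨by rwa [Measure.restrict_apply_univ]⟩
  have hκabs : ∀ᵐ x ∂(volume.restrict U), |κ x| ≤ κ₁ := by
    filter_upwards [hκ] with x hx
    rw [abs_of_pos (hκ₀.trans_le hx.1)]
    exact hx.2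
  have hκs : AEStronglyMeasurable κ (volume.restrict U) := hκm.aestronglyMeasurable
  have hB : MemLp (fun x => κ x • (gradient g x + gr w x)) 2 (volume.restrict U) :=
    memLp_smul_of_ae_bound hκs hκabs (hgrad.add (Lp.memLp w.2))
  have hgm : AEStronglyMeasurable g (volume.restrict U) :=
    ContinuousOn.aestronglyMeasurable
      (fun x hx => (hg x hx).continuousAt.continuousWithinAt) hmeas
  have hr : MemLp (fun x => ρ (g x + fn w x - M)) 2 (volume.restrict U) := by
    refine MemLp.of_bound (hρc.continuous.comp_aestronglyMeasurable
      ((hgm.add (Lp.aestronglyMeasurable w.1)).sub aestronglyMeasurable_const)) 1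
      (Filter.Eventually.of_forall fun x => ?_)
    rw [Real.norm_eq_abs, abs_of_nonneg (Real.smoothTransition.nonneg _)]
    exact Real.smoothTransition.le_one _
  -- Instead of testing with ρ(g + w - M), whose membership in H^1_0 would need proof, the smooth
  -- truncation q = ρ(g + φ - M) is used, with φ near w. Its gradient is controlled by that of φ -
  -- w, then q by Poincaré, and ρ(g + w - M) differs from q by at most L |φ - w|.
  have key : ∀ p ∈ testPairs U,
      ‖hr.toLp _‖ ≤ (L + 2 * R * (L * κ₁ / κ₀)) * ‖p - w‖ := by
    rintro p ⟨φ, hφ, hφc, hφU, hp1, hp2⟩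
    obtain ⟨hzc, hzs⟩ := truncation_contDiff hU hρc
      (fun t ht => Real.smoothTransition.zero_of_nonpos ht) hg hgM hφ hφU
    obtain ⟨q, hq, hq1, hq2⟩ := exists_mem_testPairs hzc
      (hφc.of_isClosed_subset (isClosed_tsupport _) hzs) (hzs.trans hφU)
    have hqH := testPairs_subset_H10 hq
    have hq2' : ∀ᵐ x ∂(volume.restrict U), gr q x =
        deriv ρ (g x + φ x - M) • (gradient g x + gr p x) := by
      filter_upwards [hq2, hp2, ae_restrict_mem hmeas] with x h1 h2 hx
      rw [h1, h2, gradient_truncation hU hρc M hg hφ hx]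
    have hA : MemLp (fun x => κ x • (gr p x - gr w x)) 2 (volume.restrict U) :=
      memLp_smul_of_ae_bound hκs hκabs ((Lp.memLp p.2).sub (Lp.memLp w.2))
    have hinB : inner ℝ (hB.toLp _) q.2 = 0 := by
      rw [L2.inner_def, ← hsol q hqH]
      refine integral_congr_ae ?_
      filter_upwards [hB.coeFn_toLp] with x hx
      rw [hx, real_inner_smul_left]
    have hinA : inner ℝ (hA.toLp _) q.2 ≤ κ₁ * ‖p.2 - w.2‖ * ‖q.2‖ := by
      refine (real_inner_le_norm _ _).trans ?_
      gcongr
      refine Lp.norm_le_mul_norm_of_ae_le_mul ?_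
      filter_upwards [hA.coeFn_toLp, Lp.coeFn_sub p.2 w.2, hκabs] with x h1 h2 h3
      rw [h1, h2, norm_smul, Real.norm_eq_abs, Pi.sub_apply]
      gcongr
    -- Pointwise this is κ₀ ρ'² |∇(g + φ)|² ≤ L κ ρ' |∇(g + φ)|², from 0 ≤ ρ' ≤ L and κ₀ ≤ κ. On the
    -- right ∇(g + φ) is split as ∇(φ - w) + ∇(g + w), and the second part drops out by the
    -- equation.
    have hq2n : κ₀ * ‖q.2‖ ^ 2 ≤ L * (inner ℝ (hA.toLp _) q.2 + inner ℝ (hB.toLp _) q.2) := by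
      rw [← real_inner_self_eq_norm_sq, ← inner_add_left, L2.inner_def, L2.inner_def,
        ← integral_const_mul, ← integral_const_mul]
      refine integral_mono_ae ((L2.integrable_inner _ _).const_mul _)
        ((L2.integrable_inner _ _).const_mul _) ?_
      filter_upwards [hq2', hA.coeFn_toLp, hB.coeFn_toLp, Lp.coeFn_add (hA.toLp _) (hB.toLp _),
        hκ] with x h1 h2 h3 h4 h5
      have h1' : q.2 x = deriv ρ (g x + φ x - M) • (gradient g x + gr p x) := h1
      have h6 : κ x • (gr p x - gr w x) + κ x • (gradient g x + gr w x) =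
          κ x • (gradient g x + gr p x) := by
        rw [← smul_add]
        congr 1
        abel
      rw [h4, Pi.add_apply, h2, h3, h1', h6]
      simp only [real_inner_smul_left, real_inner_smul_right, real_inner_self_eq_norm_sq]
      rw [norm_smul, Real.norm_eq_abs, mul_pow, sq_abs]
      set δ := deriv ρ (g x + φ x - M)
      have hδ : δ * δ ≤ L * δ :=
        mul_le_mul_of_nonneg_right ((le_abs_self _).trans (hL _)) (hρ' _)
      have hδ0 : 0 ≤ L * δ := mul_nonneg hL0 (hρ' _)
      have hX : 0 ≤ ‖gradient g x + gr p x‖ ^ 2 := sq_nonneg _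
      calc κ₀ * (δ ^ 2 * ‖gradient g x + gr p x‖ ^ 2)
          = (δ * δ) * (κ₀ * ‖gradient g x + gr p x‖ ^ 2) := by ring
        _ ≤ (L * δ) * (κ x * ‖gradient g x + gr p x‖ ^ 2) := by
            refine mul_le_mul hδ (mul_le_mul_of_nonneg_right h5.1 hX) (by positivity) hδ0
        _ = _ := by ring
    have hq2le : ‖q.2‖ ≤ L * κ₁ / κ₀ * ‖p.2 - w.2‖ := by
      rw [hinB, add_zero] at hq2n
      have h1 := mul_le_mul_of_nonneg_left hinA hL0
      rcases (norm_nonneg q.2).eq_or_lt with h0 | h0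
      · rw [← h0]
        positivity
      · rw [div_mul_eq_mul_div, le_div_iff₀ hκ₀]
        refine le_of_mul_le_mul_right ?_ h0
        calc ‖q.2‖ * κ₀ * ‖q.2‖ = κ₀ * ‖q.2‖ ^ 2 := by ring
          _ ≤ _ := hq2n
          _ ≤ _ := h1
          _ = _ := by ring
    have hq1le : ‖q.1‖ ≤ 2 * R * (L * κ₁ / κ₀ * ‖p.2 - w.2‖) :=
      (norm_fst_le_of_mem_H10 hd hR0 hR hqH).trans (by gcongr)
    have hdiff : ‖hr.toLp _ - q.1‖ ≤ L * ‖p.1 - w.1‖ := by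
      refine Lp.norm_le_mul_norm_of_ae_le_mul ?_
      filter_upwards [hr.coeFn_toLp, Lp.coeFn_sub (hr.toLp _) q.1, Lp.coeFn_sub p.1 w.1, hq1, hp1,
        ae_restrict_mem hmeas] with x h1 h2 h3 h4 h5 hx
      have h4' : q.1 x = ρ (g x + φ x - M) := h4.trans (indicator_of_mem hx _)
      have h5' : p.1 x = φ x := h5
      rw [h2, h3, Pi.sub_apply, Pi.sub_apply, h1, h4', h5', Real.norm_eq_abs, Real.norm_eq_abs,
        abs_sub_comm (φ x)]
      refine (hρL _ _).trans (le_of_eq ?_)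
      congr 2
      simp only [fn]
      ring
    have hn1 : ‖p.1 - w.1‖ ≤ ‖p - w‖ := norm_fst_le (p - w)
    have hn2 : ‖p.2 - w.2‖ ≤ ‖p - w‖ := norm_snd_le (p - w)
    have h1 : ‖hr.toLp _‖ ≤ ‖hr.toLp _ - q.1‖ + ‖q.1‖ := by
      simpa using norm_add_le (hr.toLp _ - q.1) q.1
    have h2 : L * ‖p.1 - w.1‖ ≤ L * ‖p - w‖ := by gcongr
    have h3 : 2 * R * (L * κ₁ / κ₀ * ‖p.2 - w.2‖) ≤ 2 * R * (L * κ₁ / κ₀ * ‖p - w‖) := by gcongr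
    rw [add_mul, mul_assoc (2 * R)]
    linarith
  have hzero : ‖hr.toLp _‖ = 0 := by
    refine le_antisymm (le_of_forall_pos_le_add fun ε hε => ?_) (norm_nonneg _)
    set C := L + 2 * R * (L * κ₁ / κ₀)
    have hC : 0 ≤ C := by positivity
    obtain ⟨p, hp, hpw⟩ := exists_testPair_norm_sub_lt hw (ε := ε / (C + 1)) (by positivity)
    rw [zero_add]
    calc _ ≤ C * ‖p - w‖ := key p hp
      _ ≤ C * (ε / (C + 1)) := by gcongr
      _ ≤ (C + 1) * (ε / (C + 1)) := by gcongr; linarith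
      _ = ε := by field_simp
  filter_upwards [hr.coeFn_toLp, (Lp.eq_zero_iff_ae_eq_zero).1 (norm_eq_zero.1 hzero)] with x h1 h2
  rw [h1] at h2
  have := Real.smoothTransition.zero_iff_nonpos.1 h2
  linarith

end WeakSolution

end CEM

/-! ### The Caccioppoli estimate and passage to all of H^1_0 -/

namespace CEM

section Caccioppoli

variable {d : ℕ} {U : Set (E d)} {κ : E d → ℝ} {κ₀ κ₁ : ℝ} {g : E d → ℝ} {w : Pair U}

/-- The Caccioppoli estimate, up to the boundary, for a weak solution `g + w` of
`-div(κ ∇(g + w)) = 0` with boundary values `g` and bounded `w`. -/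
lemma integral_sq_mul_sq_le_of_weak_solution (hU : MeasurableSet U)
    (hκm : AEMeasurable κ (volume.restrict U)) (hκ₀ : 0 < κ₀)
    (hκ : ∀ᵐ x ∂(volume.restrict U), κ₀ ≤ κ x ∧ κ x ≤ κ₁)
    {M : ℝ} (hgM : ∀ x ∈ U, ‖gradient g x‖ ≤ M)
    (hgrad : MemLp (gradient g) 2 (volume.restrict U)) (hw : w ∈ H10 U)
    (hw1 : ∀ᵐ x ∂(volume.restrict U), |fn w x| ≤ 1)
    (hsol : ∀ z ∈ H10 U, aForm κ U (fun x => gradient g x + gr w x) (gr z) = 0)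
    {v : E d → ℝ} (hv : ContDiff ℝ ∞ v) (hvc : HasCompactSupport v) :
    Integrable (fun x => κ x * ‖gradient g x + gr w x‖ ^ 2 * v x ^ 2) (volume.restrict U) ∧
    ∫ x in U, κ x * ‖gradient g x + gr w x‖ ^ 2 * v x ^ 2 ≤
      2 * κ₁ * (M ^ 2 * ∫ x in U, v x ^ 2) + 2 * κ₁ * (4 * ∫ x in U, ‖gradient v x‖ ^ 2) := by
  set μ := (volume : Measure (E d)).restrict U
  set G : E d → E d := fun x => gradient g x + gr w x with hGdef
  have hG : MemLp G 2 μ := hgrad.add (Lp.memLp w.2)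
  have hκs : AEStronglyMeasurable κ μ := hκm.aestronglyMeasurable
  have hκabs : ∀ᵐ x ∂μ, |κ x| ≤ κ₁ := by
    filter_upwards [hκ] with x hx
    rw [abs_of_pos (hκ₀.trans_le hx.1)]
    exact hx.2
  obtain ⟨Cv, hCv⟩ := hv.continuous.bounded_above_of_compact_support hvc
  obtain ⟨Cg, hCg⟩ := (continuous_gradient hv).bounded_above_of_compact_support
    (hasCompactSupport_gradient hvc)
  have hκG : MemLp (fun x => κ x • G x) 2 μ := memLp_smul_of_ae_bound hκs hκabs hG
  have hvG : MemLp (fun x => v x • G x) 2 μ :=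
    memLp_smul_of_ae_bound hv.continuous.aestronglyMeasurable
      (Filter.Eventually.of_forall hCv) hG
  have hκvG : MemLp (fun x => κ x • v x • G x) 2 μ := memLp_smul_of_ae_bound hκs hκabs hvG
  have hA : MemLp (fun x => v x • κ x • v x • G x) 2 μ :=
    memLp_smul_of_ae_bound hv.continuous.aestronglyMeasurable
      (Filter.Eventually.of_forall hCv) hκvG
  have hB : MemLp (fun x => 2 * inner ℝ (gradient v x) (κ x • v x • G x)) 2 μ := by
    refine MemLp.const_mul (hκvG.of_le_mul (c := Cg) ?_ (Filter.Eventually.of_forall fun x => ?_)) 2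
    · exact ((continuous_gradient hv).aestronglyMeasurable).inner hκvG.1
    · refine (norm_inner_le_norm _ _).trans ?_
      gcongr
      exact hCg x
  -- F(p) = ∫ κ G · ∇(p v²), written as a continuous functional on pairs. It vanishes on test
  -- functions by the equation, hence at `w` by density. No cutoff at the boundary is required of
  -- `v`, since `w` itself lies in H^1_0.
  let F : Pair U → ℝ := fun p => inner ℝ (hA.toLp _) p.2 + inner ℝ (hB.toLp _) p.1
  have hFc : Continuous F := by fun_prop
  have hF0 : F w = 0 := by
    rw [← SetLike.mem_coe, H10_eq_closure] at hw
    refine closure_minimal (t := {p | F p = 0}) ?_ (isClosed_eq hFc continuous_const) hw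
    rintro p ⟨φ, hφ, hφc, hφU, hp1, hp2⟩
    have hsm : ContDiff ℝ ∞ fun x => φ x * (v x * v x) := hφ.mul (hv.mul hv)
    obtain ⟨q, hq, hq1, hq2⟩ := exists_mem_testPairs (U := U) hsm hφc.mul_right
      ((tsupport_mul_subset_left).trans hφU)
    have h0 := hsol q (testPairs_subset_H10 hq)
    change inner ℝ (hA.toLp _) p.2 + inner ℝ (hB.toLp _) p.1 = 0
    rw [← h0, L2.inner_def, L2.inner_def, aForm,
      ← integral_add (L2.integrable_inner _ _) (L2.integrable_inner _ _)]
    refine integral_congr_ae ?_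
    filter_upwards [hA.coeFn_toLp, hB.coeFn_toLp, hp1, hp2, hq2] with x h1 h2 h3 h4 h5
    have h3' : p.1 x = φ x := h3
    have h4' : p.2 x = gradient φ x := h4
    have hvd : DifferentiableAt ℝ v x := hv.differentiable (by simp) x
    have hφd : DifferentiableAt ℝ φ x := hφ.differentiable (by simp) x
    have hvd2 : DifferentiableAt ℝ (fun y => v y * v y) x := hvd.mul hvd
    rw [h5, h1, h2, h3', h4', gradient_mul_of_differentiableAt hφd hvd2,
      gradient_mul_of_differentiableAt hvd hvd]
    simp only [inner_add_right, real_inner_smul_left, real_inner_smul_right,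
      RCLike.inner_apply, conj_trivial]
    rw [real_inner_comm (G x) (gradient v x)]
    ring
  have hint : Integrable (fun x => κ x * ‖G x‖ ^ 2 * v x ^ 2) μ := by
    refine (integrable_inner_of_memLp_two hvG hκvG).congr (Filter.Eventually.of_forall fun x => ?_)
    simp only [real_inner_smul_right, real_inner_self_eq_norm_sq]
    rw [norm_smul, mul_pow, Real.norm_eq_abs, sq_abs]
    ring
  refine ⟨hint, ?_⟩
  have hi1 : Integrable (fun x => v x ^ 2) μ :=
    (memLp_of_continuous_hasCompactSupport (U := U) hv.continuous hvc).integrable_sq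
  have hi2 : Integrable (fun x => ‖gradient v x‖ ^ 2) μ :=
    (memLp_of_continuous_hasCompactSupport (U := U) (continuous_gradient hv)
      (hasCompactSupport_gradient hvc)).integrable_norm_pow two_ne_zero
  have hi3 := L2.integrable_inner (𝕜 := ℝ) (hA.toLp _) w.2
  have hi4 := L2.integrable_inner (𝕜 := ℝ) (hB.toLp _) w.1
  have hF0' : ∫ x, ((inner ℝ (hA.toLp _ x) (w.2 x) : ℝ) + inner ℝ (hB.toLp _ x) (w.1 x)) ∂μ = 0 := by
    rw [integral_add hi3 hi4, ← L2.inner_def, ← L2.inner_def]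
    exact hF0
  have hi5 : Integrable (fun x => 2 * ((inner ℝ (hA.toLp _ x) (w.2 x) : ℝ) +
      inner ℝ (hB.toLp _ x) (w.1 x))) μ := (hi3.add hi4).const_mul 2
  have hi6 : Integrable (fun x => 2 * κ₁ * (M ^ 2 * v x ^ 2)) μ := (hi1.const_mul _).const_mul _
  have hi7 : Integrable (fun x => 2 * κ₁ * (4 * ‖gradient v x‖ ^ 2)) μ :=
    (hi2.const_mul _).const_mul _
  have hi8 : Integrable (fun x => 2 * κ₁ * (M ^ 2 * v x ^ 2) +
      2 * κ₁ * (4 * ‖gradient v x‖ ^ 2)) μ := hi6.add hi7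
  -- With ∇w = G - ∇g, κ v² |G|² equals the integrand of F(w) plus κ (v² G·∇g - 2 v w G·∇v). Two
  -- Young inequalities, each costing a quarter of κ v² |G|² and using |w| ≤ 1, leave half to be
  -- absorbed; hence the factors 2.
  have hmain : ∫ x, κ x * ‖G x‖ ^ 2 * v x ^ 2 ∂μ ≤
      ∫ x, (2 * ((inner ℝ (hA.toLp _ x) (w.2 x) : ℝ) + inner ℝ (hB.toLp _ x) (w.1 x)) +
        (2 * κ₁ * (M ^ 2 * v x ^ 2) + 2 * κ₁ * (4 * ‖gradient v x‖ ^ 2))) ∂μ := by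
    refine integral_mono_ae hint (hi5.add hi8) ?_
    filter_upwards [hA.coeFn_toLp, hB.coeFn_toLp, hκ, hw1, ae_restrict_mem hU]
      with x h1 h2 hκx hwx hx
    rw [h1, h2]
    have hwG : w.2 x = G x - gradient g x := by simp [hGdef, gr]
    rw [hwG]
    simp only [inner_sub_right, real_inner_smul_left, real_inner_smul_right,
      RCLike.inner_apply, conj_trivial, real_inner_self_eq_norm_sq]
    have hk0 : 0 ≤ κ x := hκ₀.le.trans hκx.1
    have e1 : v x ^ 2 * inner ℝ (G x) (gradient g x) ≤ v x ^ 2 * (‖G x‖ ^ 2 / 4 + M ^ 2) := by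
      gcongr
      have h3 := real_inner_le_norm (G x) (gradient g x)
      have h4 := mul_le_mul_of_nonneg_left (hgM x hx) (norm_nonneg (G x))
      nlinarith [sq_nonneg (‖G x‖ / 2 - M)]
    have e2 : -(2 * (v x * inner ℝ (gradient v x) (G x)) * fn w x) ≤
        v x ^ 2 * ‖G x‖ ^ 2 / 4 + 4 * ‖gradient v x‖ ^ 2 := by
      have h3 : |inner ℝ (gradient v x) (G x)| ≤ ‖gradient v x‖ * ‖G x‖ :=
        abs_real_inner_le_norm _ _
      have h4 : |2 * (v x * inner ℝ (gradient v x) (G x)) * fn w x| ≤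
          2 * (|v x| * (‖gradient v x‖ * ‖G x‖)) * 1 := by
        rw [abs_mul, abs_mul, abs_mul, abs_two]
        gcongr
      have h5 := (neg_le_abs _).trans h4
      have h6 : v x ^ 2 = |v x| ^ 2 := (sq_abs _).symm
      rw [h6]
      nlinarith [sq_nonneg (|v x| * ‖G x‖ / 2 - 2 * ‖gradient v x‖)]
    have e3 : κ x * (v x ^ 2 * inner ℝ (G x) (gradient g x) -
        2 * (v x * inner ℝ (gradient v x) (G x)) * fn w x) ≤
        κ x * (v x ^ 2 * ‖G x‖ ^ 2 / 2) + κ₁ * (M ^ 2 * v x ^ 2 + 4 * ‖gradient v x‖ ^ 2) := by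
      have h3 : κ x * (v x ^ 2 * inner ℝ (G x) (gradient g x) -
          2 * (v x * inner ℝ (gradient v x) (G x)) * fn w x) ≤
          κ x * (v x ^ 2 * ‖G x‖ ^ 2 / 2 + (M ^ 2 * v x ^ 2 + 4 * ‖gradient v x‖ ^ 2)) := by
        refine mul_le_mul_of_nonneg_left ?_ hk0
        linarith
      have h4 : κ x * (M ^ 2 * v x ^ 2 + 4 * ‖gradient v x‖ ^ 2) ≤
          κ₁ * (M ^ 2 * v x ^ 2 + 4 * ‖gradient v x‖ ^ 2) :=
        mul_le_mul_of_nonneg_right hκx.2 (by positivity)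
      linarith
    have e4 : w.1 x = fn w x := rfl
    rw [e4]
    linarith
  refine hmain.trans (le_of_eq ?_)
  rw [integral_add hi5 hi8, integral_add hi6 hi7]
  simp only [integral_const_mul]
  rw [hF0']
  ring

end Caccioppoli

section Density

variable {d : ℕ} {Ω U : Set (E d)}

/-- A weight that satisfies `∫_U γ φ² ≤ C ‖φ‖²_{H^1}` for test functions makes the squares of all
elements of `H^1_0(Ω)` integrable. -/
lemma integrable_weight_mul_sq (hUΩ : U ⊆ Ω) {γ : E d → ℝ}
    (hγm : AEStronglyMeasurable γ (volume.restrict U))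
    (hγ0 : ∀ᵐ x ∂(volume.restrict U), 0 ≤ γ x) {A B : ℝ} (hA : 0 ≤ A) (hB : 0 ≤ B)
    (h : ∀ φ : E d → ℝ, ContDiff ℝ ∞ φ → HasCompactSupport φ →
      Integrable (fun x => γ x * φ x ^ 2) (volume.restrict U) ∧
      ∫ x in U, γ x * φ x ^ 2 ≤
        A * (∫ x in U, φ x ^ 2) + B * ∫ x in U, ‖gradient φ x‖ ^ 2)
    {v : Pair Ω} (hv : v ∈ H10 Ω) :
    Integrable (fun x => γ x * fn v x ^ 2) (volume.restrict U) := by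
  have hle : (volume : Measure (E d)).restrict U ≤ volume.restrict Ω := Measure.restrict_mono_set _ hUΩ
  have hac : ∀ {P : E d → Prop}, (∀ᵐ x ∂(volume.restrict Ω), P x) →
      ∀ᵐ x ∂(volume.restrict U), P x := fun h => ae_mono hle h
  have htest : ∀ p ∈ testPairs Ω,
      ∫⁻ x in U, ENNReal.ofReal (γ x * fn p x ^ 2) ≤
        ENNReal.ofReal (A * ‖p.1‖ ^ 2 + B * ‖p.2‖ ^ 2) := by
    rintro p ⟨φ, hφ, hφc, _, hp1, hp2⟩
    obtain ⟨h1, h2⟩ := h φ hφ hφc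
    have h3 : ∫⁻ x in U, ENNReal.ofReal (γ x * fn p x ^ 2) =
        ∫⁻ x in U, ENNReal.ofReal (γ x * φ x ^ 2) := by
      refine lintegral_congr_ae ?_
      filter_upwards [hac hp1] with x hx
      rw [hx]
    rw [h3, ← ofReal_integral_eq_lintegral_ofReal h1
      (hγ0.mono fun x hx => mul_nonneg hx (sq_nonneg _))]
    refine ENNReal.ofReal_le_ofReal (h2.trans ?_)
    have e1 : ∫ x in U, φ x ^ 2 ≤ ‖p.1‖ ^ 2 := by
      have e0 : ∫ x in Ω, ‖p.1 x‖ ^ 2 = ∫ x in Ω, φ x ^ 2 := by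
        refine integral_congr_ae ?_
        filter_upwards [hp1] with x (hx : p.1 x = _)
        rw [hx, Real.norm_eq_abs, sq_abs]
      rw [norm_Lp_two_sq, e0]
      exact integral_mono_measure hle (Filter.Eventually.of_forall fun x => sq_nonneg _)
        (memLp_of_continuous_hasCompactSupport (U := Ω) hφ.continuous hφc).integrable_sq
    have e2 : ∫ x in U, ‖gradient φ x‖ ^ 2 ≤ ‖p.2‖ ^ 2 := by
      have e0 : ∫ x in Ω, ‖p.2 x‖ ^ 2 = ∫ x in Ω, ‖gradient φ x‖ ^ 2 := by
        refine integral_congr_ae ?_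
        filter_upwards [hp2] with x (hx : p.2 x = _)
        rw [hx]
      rw [norm_Lp_two_sq, e0]
      exact integral_mono_measure hle (Filter.Eventually.of_forall fun x => sq_nonneg _)
        ((memLp_of_continuous_hasCompactSupport (U := Ω) (continuous_gradient hφ)
          (hasCompactSupport_gradient hφc)).integrable_norm_pow two_ne_zero)
    gcongr
  have hseq : ∀ n : ℕ, ∃ p ∈ testPairs Ω, ‖p - v‖ < 1 / ((n : ℝ) + 1) := fun n =>
    exists_testPair_norm_sub_lt hv (by positivity)
  choose p hp hpv using hseq
  have hlim : Filter.Tendsto (fun n => (p n).1) Filter.atTop (nhds v.1) := by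
    rw [tendsto_iff_norm_sub_tendsto_zero]
    exact squeeze_zero (fun n => norm_nonneg _)
      (fun n => (norm_fst_le (p n - v)).trans (hpv n).le) tendsto_one_div_add_atTop_nhds_zero_nat
  obtain ⟨ns, _, hns⟩ := (tendstoInMeasure_of_tendsto_Lp hlim).exists_seq_tendsto_ae
  set D := A * (‖v‖ + 1) ^ 2 + B * (‖v‖ + 1) ^ 2
  have hbound : ∀ n, ∫⁻ x in U, ENNReal.ofReal (γ x * fn (p n) x ^ 2) ≤ ENNReal.ofReal D := by
    intro n
    refine (htest _ (hp n)).trans (ENNReal.ofReal_le_ofReal ?_)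
    have h1 : ‖p n‖ ≤ ‖v‖ + 1 := by
      have h2 : 1 / ((n : ℝ) + 1) ≤ 1 := by
        rw [div_le_one (by positivity)]
        linarith [(n.cast_nonneg : (0 : ℝ) ≤ n)]
      have h3 := norm_add_le (p n - v) v
      rw [sub_add_cancel] at h3
      linarith [hpv n]
    have h2 := (norm_fst_le (p n)).trans h1
    have h3 := (norm_snd_le (p n)).trans h1
    simp only [D]
    gcongr
  have hm : ∀ q : Pair Ω, AEStronglyMeasurable (fun x => γ x * fn q x ^ 2) (volume.restrict U) :=
    fun q => hγm.mul (((Lp.aestronglyMeasurable q.1).mono_measure hle).pow 2)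
  refine ⟨hm v, ?_⟩
  rw [hasFiniteIntegral_iff_ofReal (hγ0.mono fun x hx => mul_nonneg hx (sq_nonneg _))]
  -- Fatou's lemma along an almost everywhere convergent subsequence of test functions, whose
  -- weighted integrals are bounded by the H¹ bound.
  calc ∫⁻ x in U, ENNReal.ofReal (γ x * fn v x ^ 2)
      = ∫⁻ x in U, Filter.liminf (fun n => ENNReal.ofReal (γ x * fn (p (ns n)) x ^ 2))
          Filter.atTop := by
        refine lintegral_congr_ae ?_
        filter_upwards [hac hns] with x hx
        exact ((ENNReal.continuous_ofReal.tendsto _).comp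
          ((hx.pow 2).const_mul (γ x))).liminf_eq.symm
    _ ≤ Filter.liminf (fun n => ∫⁻ x in U, ENNReal.ofReal (γ x * fn (p (ns n)) x ^ 2))
          Filter.atTop :=
        lintegral_liminf_le' fun n => (hm _).aemeasurable.ennreal_ofReal
    _ ≤ ENNReal.ofReal D :=
        Filter.liminf_le_of_le (by isBoundedDefault) fun b hb => by
          obtain ⟨n, hn⟩ := hb.exists
          exact hn.trans (hbound _)
    _ < ⊤ := ENNReal.ofReal_lt_top

end Density

end CEM

/-! ### Finiteness of the weighted form on V -/

namespace CEM

section Nodal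

variable {d : ℕ} {Ω : Set (E d)} (T : CoarseMesh Ω) (i : Fin T.N)

lemma CoarseMesh.isFiniteMeasure_restrict_K : IsFiniteMeasure (volume.restrict (T.K i)) :=
  ⟨by
    rw [Measure.restrict_apply_univ]
    exact (T.isBounded_K i).measure_lt_top⟩

lemma CoarseMesh.memLp_gradient_nodal (j : Fin T.Nc) :
    MemLp (gradient (T.nodal i j)) 2 (volume.restrict (T.K i)) := by
  have := T.isFiniteMeasure_restrict_K i
  obtain ⟨M, _, hM⟩ := T.exists_norm_gradient_nodal_le i
  have hcont : ContinuousOn (gradient (T.nodal i j)) (T.K i) := by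
    have h1 : ContDiffOn ℝ ∞ (T.nodal i j) (T.K i) := fun x hx =>
      (T.contDiffAt_nodal i j hx).contDiffWithinAt
    exact (LinearIsometryEquiv.continuous _).comp_continuousOn
      (h1.continuousOn_fderiv_of_isOpen (T.isOpen_K i) (by simp))
  refine MemLp.of_bound (hcont.aestronglyMeasurable (T.isOpen_K i).measurableSet) M ?_
  filter_upwards [ae_restrict_mem (T.isOpen_K i).measurableSet] with x hx
  exact hM j x hx

lemma aForm_congr {κ : E d → ℝ} {K : Set (E d)} {g g' h h' : E d → E d}
    (hg : g =ᵐ[volume.restrict K] g') (hh : h =ᵐ[volume.restrict K] h') :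
    aForm κ K g h = aForm κ K g' h' := by
  refine integral_congr_ae ?_
  filter_upwards [hg, hh] with x h1 h2
  rw [h1, h2]

lemma sForm_congr {κ : E d → ℝ} {K : Set (E d)} {g g' h h' : E d → ℝ}
    (hg : g =ᵐ[volume.restrict K] g') (hh : h =ᵐ[volume.restrict K] h') :
    sForm κ K g h = sForm κ K g' h' := by
  refine integral_congr_ae ?_
  filter_upwards [hg, hh] with x h1 h2
  rw [h1, h2]

variable {κ : E d → ℝ} {κ₀ κ₁ : ℝ} {G : Fin T.Nc → E d → E d} {χ : Fin T.Nc → E d → ℝ}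

/-- Squares of elements of `H^1_0(Ω)` are integrable for the weight that comes from a multiscale
basis function. -/
lemma integrable_multiscale_weight (hd : 1 ≤ d) (hκm : AEMeasurable κ (volume.restrict (T.K i)))
    (hκ₀ : 0 < κ₀) (hκ₁ : 0 ≤ κ₁)
    (hκ : ∀ᵐ x ∂(volume.restrict (T.K i)), κ₀ ≤ κ x ∧ κ x ≤ κ₁) (hPU : T.IsMultiscalePU κ χ G)
    (j : Fin T.Nc) {v : Pair Ω} (hv : v ∈ H10 Ω) :
    Integrable (fun x => κ x * ‖G j x‖ ^ 2 * fn v x ^ 2) (volume.restrict (T.K i)) := by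
  obtain ⟨⟨w, hw, _, hG⟩, hsol⟩ := hPU i j
  obtain ⟨M, _, hM⟩ := T.exists_norm_gradient_nodal_le i
  have hgrad := T.memLp_gradient_nodal i j
  have hopen := T.isOpen_K i
  obtain ⟨R, hR0, hR⟩ := (T.isBounded_K i).exists_pos_norm_le
  have hsol' : ∀ z ∈ H10 (T.K i),
      aForm κ (T.K i) (fun x => gradient (T.nodal i j) x + gr w x) (gr z) = 0 := fun z hz => by
    rw [← hsol z hz]
    exact aForm_congr hG.symm (Filter.EventuallyEq.refl _ _)
  have hupper := ae_add_le_of_weak_solution hd hopen hR0.le hR hκm hκ₀ hκ₁ hκ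
    (fun x hx => T.contDiffAt_nodal i j hx) (fun x hx => T.nodal_le_one i j hx) hgrad hw hsol'
  have hgneg : gradient (fun x => (-1) * T.nodal i j x) =ᵐ[volume.restrict (T.K i)]
      fun x => (-1 : ℝ) • gradient (T.nodal i j) x := by
    filter_upwards [ae_restrict_mem hopen.measurableSet] with x hx
    exact gradient_const_mul_of_differentiableAt _
      ((T.contDiffAt_nodal i j hx).differentiableAt (by simp))
  have hwneg : gr (-w) =ᵐ[volume.restrict (T.K i)] fun x => -gr w x := Lp.coeFn_neg w.2
  -- The minimum principle, as the maximum principle for -χ_j. Since both χ_j and the nodal function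
  -- lie in [0, 1], their difference satisfies |w| ≤ 1.
  have hlower := ae_add_le_of_weak_solution (w := -w) (g := fun x => (-1) * T.nodal i j x) (M := 0)
    hd hopen hR0.le hR hκm hκ₀ hκ₁ hκ
    (fun x hx => contDiffAt_const.mul (T.contDiffAt_nodal i j hx))
    (fun x hx => by linarith [T.nodal_nonneg i j hx])
    ((hgrad.const_smul (-1 : ℝ)).ae_eq hgneg.symm) (neg_mem hw) (fun z hz => by
      have h0 := hsol' z hz
      rw [aForm] at h0 ⊢
      rw [← neg_eq_zero, ← integral_neg, ← h0]
      refine integral_congr_ae ?_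
      filter_upwards [hgneg, hwneg] with x h1 h2
      rw [h1, h2, neg_one_smul, ← neg_add, inner_neg_left]
      ring)
  have hw1 : ∀ᵐ x ∂(volume.restrict (T.K i)), |fn w x| ≤ 1 := by
    filter_upwards [hupper, hlower, Lp.coeFn_neg w.1, ae_restrict_mem hopen.measurableSet]
      with x h1 h2 h3 hx
    have h3' : fn (-w) x = -fn w x := h3
    rw [h3'] at h2
    have h4 := T.nodal_nonneg i j hx
    have h5 := T.nodal_le_one i j hx
    exact abs_le.2 ⟨by linarith, by linarith⟩
  have hGm : AEStronglyMeasurable (fun x => gradient (T.nodal i j) x + gr w x)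
      (volume.restrict (T.K i)) := hgrad.1.add (Lp.aestronglyMeasurable w.2)
  have h := integrable_weight_mul_sq (T.K_subset i)
    (γ := fun x => κ x * ‖gradient (T.nodal i j) x + gr w x‖ ^ 2)
    (hκm.aestronglyMeasurable.mul (hGm.norm.pow 2))
    (hκ.mono fun x hx => mul_nonneg (hκ₀.le.trans hx.1) (sq_nonneg _))
    (A := 2 * κ₁ * M ^ 2) (B := 2 * κ₁ * 4) (by positivity) (by positivity)
    (fun φ hφ hφc => by
      have h1 := integral_sq_mul_sq_le_of_weak_solution hopen.measurableSet hκm hκ₀ hκ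
        (hM j) hgrad hw hw1 hsol' hφ hφc
      refine ⟨h1.1, h1.2.trans (le_of_eq ?_)⟩
      ring) hv
  refine h.congr ?_
  filter_upwards [hG] with x hx
  rw [hx]

lemma aestronglyMeasurable_of_isPU (hPU : T.IsMultiscalePU κ χ G ∨ T.IsBilinearPU χ G)
    (j : Fin T.Nc) : AEStronglyMeasurable (G j) (volume.restrict (T.K i)) := by
  rcases hPU with h | h
  · obtain ⟨⟨w, _, _, hG⟩, _⟩ := h i j
    exact ((T.memLp_gradient_nodal i j).1.add (Lp.aestronglyMeasurable w.2)).congr hG.symm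
  · exact (T.memLp_gradient_nodal i j).1.congr (h i j).2.symm

lemma aestronglyMeasurable_kappaTilde (hκm : AEMeasurable κ (volume.restrict (T.K i)))
    (hPU : T.IsMultiscalePU κ χ G ∨ T.IsBilinearPU χ G) :
    AEStronglyMeasurable (kappaTilde κ G) (volume.restrict (T.K i)) := by
  refine Finset.aestronglyMeasurable_fun_sum _ fun j _ => ?_
  exact hκm.aestronglyMeasurable.mul ((aestronglyMeasurable_of_isPU T i hPU j).norm.pow 2)

/-- Squares of elements of `H^1_0(Ω)` are integrable for the weight `κ̃`. -/
lemma integrable_kappaTilde_mul_sq (hd : 1 ≤ d)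
    (hκm : AEMeasurable κ (volume.restrict (T.K i))) (hκ₀ : 0 < κ₀) (hκ₁ : 0 ≤ κ₁)
    (hκ : ∀ᵐ x ∂(volume.restrict (T.K i)), κ₀ ≤ κ x ∧ κ x ≤ κ₁)
    (hPU : T.IsMultiscalePU κ χ G ∨ T.IsBilinearPU χ G) {v : Pair Ω} (hv : v ∈ H10 Ω) :
    Integrable (fun x => kappaTilde κ G x * fn v x ^ 2) (volume.restrict (T.K i)) := by
  have h : ∀ j, Integrable (fun x => κ x * ‖G j x‖ ^ 2 * fn v x ^ 2) (volume.restrict (T.K i)) := by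
    intro j
    have hGm := aestronglyMeasurable_of_isPU T i hPU j
    rcases hPU with h | h
    · exact integrable_multiscale_weight T i hd hκm hκ₀ hκ₁ hκ h j hv
    · obtain ⟨M, hM0, hM⟩ := T.exists_norm_gradient_nodal_le i
      have hv2 : Integrable (fun x => fn v x ^ 2) (volume.restrict (T.K i)) :=
        ((Lp.memLp v.1).integrable_sq).mono_measure (Measure.restrict_mono_set _ (T.K_subset i))
      refine hv2.bdd_mul (c := κ₁ * M ^ 2)
        (hκm.aestronglyMeasurable.mul (hGm.norm.pow 2)) ?_
      filter_upwards [hκ, (h i j).2, ae_restrict_mem (T.isOpen_K i).measurableSet] with x h1 h2 hx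
      rw [h2, Real.norm_eq_abs,
        abs_of_nonneg (mul_nonneg (hκ₀.le.trans h1.1) (sq_nonneg _))]
      have h3 := hM j x hx
      exact mul_le_mul h1.2 (by gcongr) (sq_nonneg _) hκ₁
  simp only [kappaTilde, Finset.sum_mul]
  exact integrable_finsetSum _ fun j _ => h j

end Nodal

/-! ### The bilinear forms and the local spectral bound -/

section Forms

variable {d : ℕ} {Ω U : Set (E d)} {κ : E d → ℝ} {κ₁ : ℝ}

lemma integrable_weight_inner (hκm : AEMeasurable κ (volume.restrict U))
    (hκ : ∀ᵐ x ∂(volume.restrict U), |κ x| ≤ κ₁) (p q : Pair U) :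
    Integrable (fun x => κ x * inner ℝ (gr p x) (gr q x)) (volume.restrict U) := by
  refine (integrable_inner_of_memLp_two (memLp_smul_of_ae_bound hκm.aestronglyMeasurable hκ
    (Lp.memLp p.2)) (Lp.memLp q.2)).congr (Filter.Eventually.of_forall fun x => ?_)
  simp only [real_inner_smul_left]

/-- The energy form as a bilinear map. -/
lemma exists_bilin_aForm (hκm : AEMeasurable κ (volume.restrict U))
    (hκ : ∀ᵐ x ∂(volume.restrict U), |κ x| ≤ κ₁) :
    ∃ a : Pair U →ₗ[ℝ] Pair U →ₗ[ℝ] ℝ, ∀ p q, a p q = aForm κ U (gr p) (gr q) := by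
  have hi := integrable_weight_inner (U := U) hκm hκ
  have hcomm : ∀ p q : Pair U, aForm κ U (gr p) (gr q) = aForm κ U (gr q) (gr p) := fun p q => by
    simp only [aForm]
    congr 1
    funext x
    rw [real_inner_comm]
  have hadd : ∀ p q r : Pair U, aForm κ U (gr (p + q)) (gr r) =
      aForm κ U (gr p) (gr r) + aForm κ U (gr q) (gr r) := fun p q r => by
    rw [aForm, aForm, aForm, ← integral_add (hi p r) (hi q r)]
    refine integral_congr_ae ?_
    filter_upwards [Lp.coeFn_add p.2 q.2] with x hx
    have hx' : gr (p + q) x = gr p x + gr q x := hx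
    rw [hx', inner_add_left, mul_add]
  have hsmul : ∀ (c : ℝ) (p r : Pair U), aForm κ U (gr (c • p)) (gr r) =
      c • aForm κ U (gr p) (gr r) := fun c p r => by
    rw [aForm, aForm, smul_eq_mul, ← integral_const_mul]
    refine integral_congr_ae ?_
    filter_upwards [Lp.coeFn_smul c p.2] with x hx
    have hx' : gr (c • p) x = c • gr p x := hx
    rw [hx', real_inner_smul_left]
    ring
  exact ⟨LinearMap.mk₂ ℝ (fun p q => aForm κ U (gr p) (gr q)) hadd hsmul
    (fun p q r => by rw [hcomm, hadd, hcomm q, hcomm r])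
    (fun c p q => by rw [hcomm, hsmul, hcomm q]), fun p q => rfl⟩

lemma integrable_weight_mul_mul {γ v w : E d → ℝ} {μ : Measure (E d)}
    (hγm : AEStronglyMeasurable γ μ) (hγ0 : ∀ᵐ x ∂μ, 0 ≤ γ x) (hvm : AEStronglyMeasurable v μ)
    (hwm : AEStronglyMeasurable w μ) (hv : Integrable (fun x => γ x * v x ^ 2) μ)
    (hw : Integrable (fun x => γ x * w x ^ 2) μ) : Integrable (fun x => γ x * v x * w x) μ := by
  refine (hv.add hw).mono' ((hγm.mul hvm).mul hwm) ?_
  filter_upwards [hγ0] with x hx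
  rw [Real.norm_eq_abs, mul_assoc, abs_mul, abs_of_nonneg hx, Pi.add_apply, ← mul_add]
  refine mul_le_mul_of_nonneg_left ?_ hx
  rw [abs_mul, ← sq_abs (v x), ← sq_abs (w x)]
  nlinarith [sq_nonneg (|v x| - |w x|), abs_nonneg (v x), abs_nonneg (w x)]

/-- The weighted `L²` form as a bilinear map on a space where it is finite. -/
lemma exists_bilin_sForm {γ : E d → ℝ} (hγm : AEStronglyMeasurable γ (volume.restrict U))
    (hγ0 : ∀ᵐ x ∂(volume.restrict U), 0 ≤ γ x) (W : Submodule ℝ (Pair U))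
    (hW : ∀ p ∈ W, Integrable (fun x => γ x * fn p x ^ 2) (volume.restrict U)) :
    ∃ s : W →ₗ[ℝ] W →ₗ[ℝ] ℝ, ∀ p q : W, s p q = sForm γ U (fn p.1) (fn q.1) := by
  have hi : ∀ p q : W, Integrable (fun x => γ x * fn p.1 x * fn q.1 x) (volume.restrict U) :=
    fun p q => integrable_weight_mul_mul hγm hγ0 (Lp.aestronglyMeasurable p.1.1)
      (Lp.aestronglyMeasurable q.1.1) (hW _ p.2) (hW _ q.2)
  have hcomm : ∀ p q : W, sForm γ U (fn p.1) (fn q.1) = sForm γ U (fn q.1) (fn p.1) :=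
    fun p q => by
      simp only [sForm]
      congr 1
      funext x
      ring
  have hadd : ∀ p q r : W, sForm γ U (fn (p + q).1) (fn r.1) =
      sForm γ U (fn p.1) (fn r.1) + sForm γ U (fn q.1) (fn r.1) := fun p q r => by
    rw [sForm, sForm, sForm, ← integral_add (hi p r) (hi q r)]
    refine integral_congr_ae ?_
    filter_upwards [Lp.coeFn_add p.1.1 q.1.1] with x hx
    have hx' : fn (p + q).1 x = fn p.1 x + fn q.1 x := hx
    rw [hx']
    ring
  have hsmul : ∀ (c : ℝ) (p r : W), sForm γ U (fn (c • p).1) (fn r.1) =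
      c • sForm γ U (fn p.1) (fn r.1) := fun c p r => by
    rw [sForm, sForm, smul_eq_mul, ← integral_const_mul]
    refine integral_congr_ae ?_
    filter_upwards [Lp.coeFn_smul c p.1.1] with x hx
    have hx' : fn (c • p).1 x = c • fn p.1 x := hx
    rw [hx', smul_eq_mul]
    ring
  exact ⟨LinearMap.mk₂ ℝ (fun p q => sForm γ U (fn p.1) (fn q.1)) hadd hsmul
    (fun p q r => by rw [hcomm, hadd, hcomm q, hcomm r])
    (fun c p q => by rw [hcomm, hsmul, hcomm q]), fun p q => rfl⟩

/-- `V(K)` as a subspace. -/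
def restrictedSubmodule (hU : U ⊆ Ω) : Submodule ℝ (Pair U) where
  carrier := restrictedSpace Ω U
  zero_mem' := by
    refine ⟨0, zero_mem _, ?_, ?_⟩
    · exact ((Lp.coeFn_zero ℝ 2 (volume.restrict Ω)).filter_mono
        (ae_mono (Measure.restrict_mono_set _ hU))).trans (Lp.coeFn_zero ℝ 2 _).symm
    · exact ((Lp.coeFn_zero (E d) 2 (volume.restrict Ω)).filter_mono
        (ae_mono (Measure.restrict_mono_set _ hU))).trans (Lp.coeFn_zero (E d) 2 _).symm
  add_mem' := by
    rintro p q ⟨v, hv, hv1, hv2⟩ ⟨w, hw, hw1, hw2⟩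
    have hle := ae_mono (Measure.restrict_mono_set (volume : Measure (E d)) hU)
    refine ⟨v + w, add_mem hv hw, ?_, ?_⟩
    · filter_upwards [(Lp.coeFn_add v.1 w.1).filter_mono hle, Lp.coeFn_add p.1 q.1, hv1, hw1]
        with x h1 h2 h3 h4
      have h1' : fn (v + w) x = fn v x + fn w x := h1
      have h2' : fn (p + q) x = fn p x + fn q x := h2
      rw [h1', h2', h3, h4]
    · filter_upwards [(Lp.coeFn_add v.2 w.2).filter_mono hle, Lp.coeFn_add p.2 q.2, hv2, hw2]
        with x h1 h2 h3 h4
      have h1' : gr (v + w) x = gr v x + gr w x := h1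
      have h2' : gr (p + q) x = gr p x + gr q x := h2
      rw [h1', h2', h3, h4]
  smul_mem' := by
    rintro c p ⟨v, hv, hv1, hv2⟩
    have hle := ae_mono (Measure.restrict_mono_set (volume : Measure (E d)) hU)
    refine ⟨c • v, Submodule.smul_mem _ c hv, ?_, ?_⟩
    · filter_upwards [(Lp.coeFn_smul c v.1).filter_mono hle, Lp.coeFn_smul c p.1, hv1]
        with x h1 h2 h3
      have h1' : fn (c • v) x = c • fn v x := h1
      have h2' : fn (c • p) x = c • fn p x := h2
      rw [h1', h2', h3]
    · filter_upwards [(Lp.coeFn_smul c v.2).filter_mono hle, Lp.coeFn_smul c p.2, hv2]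
        with x h1 h2 h3
      have h1' : gr (c • v) x = c • gr v x := h1
      have h2' : gr (c • p) x = c • gr p x := h2
      rw [h1', h2', h3]

/-- Elements of V and of V(K) live in different L² spaces; this moves the error to the block, where
the eigenvalue bound is available. -/
lemma exists_restriction (hU : U ⊆ Ω) {v : Pair Ω} (hv : v ∈ H10 Ω) :
    ∃ p ∈ restrictedSubmodule hU, fn v =ᵐ[volume.restrict U] fn p ∧
      gr v =ᵐ[volume.restrict U] gr p := by
  have hle := Measure.restrict_mono_set (volume : Measure (E d)) hU
  have h1 : MemLp (fn v) 2 (volume.restrict U) := (Lp.memLp v.1).mono_measure hle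
  have h2 : MemLp (gr v) 2 (volume.restrict U) := (Lp.memLp v.2).mono_measure hle
  have e1 : fn v =ᵐ[volume.restrict U] h1.toLp _ := h1.coeFn_toLp.symm
  have e2 : gr v =ᵐ[volume.restrict U] h2.toLp _ := h2.coeFn_toLp.symm
  exact ⟨(h1.toLp _, h2.toLp _), ⟨v, hv, e1, e2⟩, e1, e2⟩

/-- The local estimate `λ_{l+1} s_i(v, v) ≤ a_i(v, v)` for `v` orthogonal to the first `l`
eigenfunctions. -/
lemma IsEigenList.mul_sForm_le_aForm {γ : E d → ℝ} {lam : ℕ → ℝ} {φ : ℕ → Pair U}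
    (h : IsEigenList κ γ Ω U lam φ) (hU : U ⊆ Ω) (hκm : AEMeasurable κ (volume.restrict U))
    (hκ : ∀ᵐ x ∂(volume.restrict U), |κ x| ≤ κ₁) (hκ0 : ∀ᵐ x ∂(volume.restrict U), 0 ≤ κ x)
    (hγm : AEStronglyMeasurable γ (volume.restrict U))
    (hγ0 : ∀ᵐ x ∂(volume.restrict U), 0 ≤ γ x)
    (hγ : ∀ v ∈ H10 Ω, Integrable (fun x => γ x * fn v x ^ 2) (volume.restrict U))
    {l : ℕ} {v : Pair Ω} (hv : v ∈ H10 Ω) (horth : ∀ j < l, sForm γ U (fn v) (fn (φ j)) = 0) :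
    lam l * sForm γ U (fn v) (fn v) ≤ aForm κ U (gr v) (gr v) := by
  obtain ⟨a, ha⟩ := exists_bilin_aForm hκm hκ
  obtain ⟨s, hs⟩ := exists_bilin_sForm hγm hγ0 (restrictedSubmodule hU) (by
    rintro p ⟨v, hv, h1, -⟩
    refine (hγ v hv).congr ?_
    filter_upwards [h1] with x hx
    rw [hx])
  obtain ⟨p, hp, hp1, hp2⟩ := exists_restriction hU hv
  let W := restrictedSubmodule hU
  let Φ : ℕ → W := fun n => ⟨φ n, h.mem n⟩
  have hmain := mul_le_of_orthogonal_eigenvectors (V := W) (a.domRestrict₁₂ W W) s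
    (fun v w => by
      simp only [LinearMap.domRestrict₁₂_apply, ha, aForm]
      congr 1
      funext x
      rw [real_inner_comm])
    (fun v w => by
      simp only [hs, sForm]
      congr 1
      funext x
      ring)
    (fun v => by
      simp only [LinearMap.domRestrict₁₂_apply, ha, aForm]
      refine integral_nonneg_of_ae (hκ0.mono fun x hx => mul_nonneg hx real_inner_self_nonneg))
    (fun v => by
      simp only [hs, sForm]
      refine integral_nonneg_of_ae (hγ0.mono fun x hx => ?_)
      change 0 ≤ γ x * fn v.1 x * fn v.1 x
      rw [mul_assoc]
      exact mul_nonneg hx (mul_self_nonneg _))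
    lam Φ
    (fun n w => by
      rw [LinearMap.domRestrict₁₂_apply, ha, hs]
      exact h.eigen n w.1 w.2)
    (fun n => by rw [hs]; exact h.pos n)
    (fun m n hmn => by rw [hs]; exact h.orth m n hmn)
    h.mono
    (fun v ε hε => by
      obtain ⟨n, c, hc⟩ := h.complete v.1 v.2 ε hε
      refine ⟨n, c, ?_⟩
      rw [hs]
      simpa [Φ] using hc)
    l ⟨p, hp⟩
    (fun j hj => by
      rw [hs, ← horth j hj]
      exact sForm_congr hp1.symm (Filter.EventuallyEq.refl _ _))
  rw [hs, LinearMap.domRestrict₁₂_apply, ha] at hmain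
  rwa [sForm_congr hp1 hp1, aForm_congr hp2 hp2]

end Forms

end CEM

/-! ### Weighted Cauchy–Schwarz and decomposition over the blocks -/

namespace CEM

section WeightedCauchySchwarz

variable {d : ℕ} {Ω : Set (E d)} {γ f v : E d → ℝ}

/-- Hölder's inequality for the product of (f²/γ)^{1/2} and (γ v²)^{1/2}. Where γ = 0, finiteness of
the dual norm forces f = 0 almost everywhere, so degenerate weights are harmless. -/
lemma ofReal_integral_mul_le (hγm : AEMeasurable γ (volume.restrict Ω))
    (hγ0 : ∀ᵐ x ∂(volume.restrict Ω), 0 ≤ γ x) (hf : AEMeasurable f (volume.restrict Ω))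
    (hv : AEMeasurable v (volume.restrict Ω))
    (hint : Integrable (fun x => γ x * v x ^ 2) (volume.restrict Ω))
    (hI : invWeightNorm γ Ω f ≠ ⊤) :
    ENNReal.ofReal (∫ x in Ω, f x * v x) ≤
      invWeightNorm γ Ω f * ENNReal.ofReal (Real.sqrt (∫ x in Ω, γ x * v x ^ 2)) := by
  let A : E d → ℝ≥0∞ := fun x => ENNReal.ofReal (f x ^ 2) / ENNReal.ofReal (γ x)
  let B : E d → ℝ≥0∞ := fun x => ENNReal.ofReal (γ x * v x ^ 2)
  have hAm : AEMeasurable A (volume.restrict Ω) :=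
    (hf.pow_const 2).ennreal_ofReal.div hγm.ennreal_ofReal
  have hBm : AEMeasurable B (volume.restrict Ω) :=
    (hγm.mul (hv.pow_const 2)).ennreal_ofReal
  have hAfin : ∫⁻ x in Ω, A x ≠ ⊤ := fun h => hI (by
    rw [invWeightNorm]
    change (∫⁻ x in Ω, A x) ^ (1 / 2 : ℝ) = ⊤
    rw [h, ENNReal.top_rpow_of_pos (by norm_num)])
  have hsq : ∀ y : ℝ≥0∞, (y ^ (1 / 2 : ℝ)) ^ (2 : ℝ) = y := fun y => by
    rw [← ENNReal.rpow_mul]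
    norm_num
  have hholder := ENNReal.lintegral_mul_le_Lp_mul_Lq (volume.restrict Ω)
    Real.HolderConjugate.two_two (hAm.pow_const (1 / 2 : ℝ)) (hBm.pow_const (1 / 2 : ℝ))
  simp only [hsq, Pi.mul_apply] at hholder
  have hB : (∫⁻ x in Ω, B x) ^ (1 / 2 : ℝ) =
      ENNReal.ofReal (Real.sqrt (∫ x in Ω, γ x * v x ^ 2)) := by
    have h0 : 0 ≤ᵐ[volume.restrict Ω] fun x => γ x * v x ^ 2 :=
      hγ0.mono fun x hx => mul_nonneg hx (sq_nonneg _)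
    rw [← ofReal_integral_eq_lintegral_ofReal hint h0,
      ENNReal.ofReal_rpow_of_nonneg (integral_nonneg_of_ae h0) (by norm_num), Real.sqrt_eq_rpow]
  calc ENNReal.ofReal (∫ x in Ω, f x * v x) ≤ ‖∫ x in Ω, f x * v x‖ₑ := Real.ofReal_le_enorm _
    _ ≤ ∫⁻ x in Ω, ‖f x * v x‖ₑ := enorm_integral_le_lintegral_enorm _
    _ ≤ ∫⁻ x in Ω, A x ^ (1 / 2 : ℝ) * B x ^ (1 / 2 : ℝ) := by
        refine lintegral_mono_ae ?_
        filter_upwards [hγ0, ae_lt_top' hAm hAfin] with x h1 h2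
        rw [← ofReal_norm, Real.norm_eq_abs]
        rcases h1.eq_or_lt with h3 | h3
        · have hfx : f x = 0 := by
            by_contra hne
            refine h2.ne ?_
            simp only [A]
            rw [← h3, ENNReal.ofReal_zero, ENNReal.div_zero]
            exact (ENNReal.ofReal_pos.2 (by positivity)).ne'
          simp [hfx]
        · have e1 : A x = ENNReal.ofReal (f x ^ 2 / γ x) := (ENNReal.ofReal_div_of_pos h3).symm
          rw [e1, ENNReal.ofReal_rpow_of_nonneg (by positivity) (by norm_num),
            ENNReal.ofReal_rpow_of_nonneg (by positivity) (by norm_num),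
            ← ENNReal.ofReal_mul (by positivity), ← Real.mul_rpow (by positivity) (by positivity)]
          have e2 : f x ^ 2 / γ x * (γ x * v x ^ 2) = (f x * v x) ^ 2 := by
            field_simp
          rw [e2, ← Real.sqrt_eq_rpow, Real.sqrt_sq_eq_abs]
    _ ≤ _ := hholder
    _ = _ := by rw [hB]; rfl

lemma invWeightNorm_le_mul {γ' : E d → ℝ} {b : ℝ} (hb : 0 ≤ b)
    (h : ∀ᵐ x ∂(volume.restrict Ω), 0 < γ' x ∧ γ' x ≤ b ^ 2 * γ x) :
    invWeightNorm γ Ω f ≤ ENNReal.ofReal b * invWeightNorm γ' Ω f := by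
  have hb2 : ENNReal.ofReal b = ENNReal.ofReal (b ^ 2) ^ (1 / 2 : ℝ) := by
    rw [ENNReal.ofReal_rpow_of_nonneg (by positivity) (by norm_num), ← Real.sqrt_eq_rpow,
      Real.sqrt_sq hb]
  rw [invWeightNorm, invWeightNorm, hb2, ← ENNReal.mul_rpow_of_nonneg _ _ (by norm_num),
    ← lintegral_const_mul' _ _ ENNReal.ofReal_ne_top]
  refine ENNReal.rpow_le_rpow (lintegral_mono_ae ?_) (by norm_num)
  filter_upwards [h] with x ⟨h1, h2⟩
  have h3 : 0 < γ x := by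
    by_contra hneg
    have := mul_nonpos_of_nonneg_of_nonpos (sq_nonneg b) (not_lt.1 hneg)
    linarith
  rw [← ENNReal.ofReal_div_of_pos h3, ← ENNReal.ofReal_div_of_pos h1,
    ← ENNReal.ofReal_mul (sq_nonneg b)]
  refine ENNReal.ofReal_le_ofReal ?_
  rw [← mul_div_assoc, div_le_div_iff₀ h3 h1]
  nlinarith [mul_le_mul_of_nonneg_left h2 (sq_nonneg (f x))]

end WeightedCauchySchwarz

section Mesh

variable {d : ℕ} {Ω : Set (E d)} (T : CoarseMesh Ω)

lemma CoarseMesh.ae_restrict_iff (hd : 1 ≤ d) {P : E d → Prop} :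
    (∀ᵐ x ∂(volume.restrict Ω), P x) ↔ ∀ i, ∀ᵐ x ∂(volume.restrict (T.K i)), P x := by
  rw [T.restrict_eq hd, ae_restrict_iUnion_iff]

lemma CoarseMesh.integrable_of_forall_K (hd : 1 ≤ d) {h : E d → ℝ}
    (hh : ∀ i, Integrable h (volume.restrict (T.K i))) : Integrable h (volume.restrict Ω) := by
  rw [T.restrict_eq hd]
  exact integrableOn_finite_iUnion.2 hh

lemma CoarseMesh.integral_eq_sum (hd : 1 ≤ d) {h : E d → ℝ}
    (hh : ∀ i, Integrable h (volume.restrict (T.K i))) :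
    ∫ x in Ω, h x = ∑ i, ∫ x in T.K i, h x := by
  rw [T.restrict_eq hd]
  exact integral_iUnion_fintype (fun i => (T.isOpen_K i).measurableSet)
    (fun i i' hii' => T.disjoint_K hii') hh

variable {κt : E d → ℝ} {φ : (i : Fin T.N) → ℕ → Pair (T.K i)}

lemma CoarseMesh.ext_ae_eq (i : Fin T.N) (n : ℕ) :
    T.ext φ i n =ᵐ[volume.restrict (T.K i)] fn (φ i n) := by
  filter_upwards [ae_restrict_mem (T.isOpen_K i).measurableSet] with x hx
  exact indicator_of_mem hx _

lemma CoarseMesh.s_ext (v : E d → ℝ) (i : Fin T.N) (n : ℕ) :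
    T.s κt v (T.ext φ i n) = sForm κt (T.K i) v (fn (φ i n)) := by
  rw [CoarseMesh.s, Finset.sum_eq_single i]
  · exact sForm_congr (Filter.EventuallyEq.refl _ _) (T.ext_ae_eq i n)
  · intro i' _ hi'
    have h0 : T.ext φ i n =ᵐ[volume.restrict (T.K i')] fun _ => 0 := by
      filter_upwards [ae_restrict_mem (T.isOpen_K i').measurableSet] with x hx
      exact indicator_of_notMem ((T.disjoint_K hi').notMem_of_mem_left hx) _
    rw [sForm_congr (Filter.EventuallyEq.refl _ v) h0]
    simp [sForm]
  · simp

lemma exists_linear_sForm {U : Set (E d)} (hU : U ⊆ Ω) {γ g : E d → ℝ}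
    (hi : ∀ v ∈ H10 Ω, Integrable (fun x => γ x * fn v x * g x) (volume.restrict U)) :
    ∃ L : H10 Ω →ₗ[ℝ] ℝ, ∀ v : H10 Ω, L v = sForm γ U (fn v.1) g := by
  have hle := ae_mono (Measure.restrict_mono_set (volume : Measure (E d)) hU)
  refine ⟨{ toFun := fun v => sForm γ U (fn v.1) g
            map_add' := fun v w => ?_
            map_smul' := fun c v => ?_ }, fun v => rfl⟩
  · rw [sForm, sForm, sForm, ← integral_add (hi _ v.2) (hi _ w.2)]
    refine integral_congr_ae ?_
    filter_upwards [(Lp.coeFn_add v.1.1 w.1.1).filter_mono hle] with x hx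
    have hx' : fn (v + w).1 x = fn v.1 x + fn w.1 x := hx
    rw [hx']
    ring
  · rw [sForm, sForm, RingHom.id_apply, smul_eq_mul, ← integral_const_mul]
    refine integral_congr_ae ?_
    filter_upwards [(Lp.coeFn_smul c v.1.1).filter_mono hle] with x hx
    have hx' : fn (c • v).1 x = c • fn v.1 x := hx
    rw [hx', smul_eq_mul]
    ring

end Mesh

/-- The purely arithmetic end of the energy estimate. -/
lemma ofReal_sqrt_le_rpow_mul {A S Λ : ℝ} {I : ℝ≥0∞} (hS : 0 ≤ S) (hΛ : Λ * S ≤ A)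
    (h : I ≠ ⊤ → ENNReal.ofReal A ≤ I * ENNReal.ofReal (Real.sqrt S)) :
    ENNReal.ofReal (Real.sqrt A) ≤ ENNReal.ofReal Λ ^ (-(1 / 2) : ℝ) * I := by
  by_cases hI : I = ⊤
  · rw [hI, ENNReal.mul_top]
    · exact le_top
    · rw [Ne, ENNReal.rpow_eq_zero_iff]
      simp
  have h1 := h hI
  -- For Λ ≤ 0 the first factor on the right is ∞, so only the case I = 0 has content, and there
  -- `h1` gives A ≤ 0.
  rcases le_or_gt Λ 0 with hΛ0 | hΛ0
  · rw [ENNReal.ofReal_of_nonpos hΛ0, ENNReal.zero_rpow_of_neg (by norm_num)]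
    by_cases hI0 : I = 0
    · rw [hI0, zero_mul] at h1
      have h2 : A ≤ 0 := ENNReal.ofReal_eq_zero.1 (le_antisymm h1 zero_le)
      rw [Real.sqrt_eq_zero_of_nonpos h2]
      simp
    · rw [ENNReal.top_mul hI0]
      exact le_top
  · have hA : 0 ≤ A := (mul_nonneg hΛ0.le hS).trans hΛ
    obtain ⟨J, rfl⟩ : ∃ J : NNReal, I = J := ⟨I.toNNReal, (ENNReal.coe_toNNReal hI).symm⟩
    rw [← ENNReal.ofReal_coe_nnreal, ← ENNReal.ofReal_mul J.coe_nonneg,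
      ENNReal.ofReal_le_ofReal_iff (by positivity)] at h1
    rw [ENNReal.ofReal_rpow_of_pos hΛ0, ← ENNReal.ofReal_coe_nnreal,
      ← ENNReal.ofReal_mul (by positivity)]
    refine ENNReal.ofReal_le_ofReal ?_
    rw [Real.rpow_neg hΛ0.le, ← Real.sqrt_eq_rpow]
    have hsΛ : 0 < Real.sqrt Λ := Real.sqrt_pos.2 hΛ0
    rw [inv_mul_eq_div, le_div_iff₀ hsΛ]
    have h2 : Real.sqrt Λ * Real.sqrt S ≤ Real.sqrt A := by
      rw [← Real.sqrt_mul hΛ0.le]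
      exact Real.sqrt_le_sqrt hΛ
    rcases (Real.sqrt_nonneg A).eq_or_lt with h3 | h3
    · rw [← h3, zero_mul]
      exact J.coe_nonneg
    -- Multiply by √A > 0 and use A ≤ J √S together with √Λ √S ≤ √A.
    · refine le_of_mul_le_mul_right ?_ h3
      calc Real.sqrt A * Real.sqrt Λ * Real.sqrt A
          = Real.sqrt Λ * (Real.sqrt A * Real.sqrt A) := by ring
        _ = Real.sqrt Λ * A := by rw [Real.mul_self_sqrt hA]
        _ ≤ Real.sqrt Λ * (J * Real.sqrt S) := by gcongr
        _ = J * (Real.sqrt Λ * Real.sqrt S) := by ring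
        _ ≤ J * Real.sqrt A := by gcongr

end CEM

/-! ### The error estimate -/

namespace CEM

lemma ae_restrict_of_subset {d : ℕ} {Ω U : Set (E d)} (hU : U ⊆ Ω) {P : E d → Prop}
    (h : ∀ᵐ x ∂(volume.restrict Ω), P x) : ∀ᵐ x ∂(volume.restrict U), P x :=
  ae_mono (Measure.restrict_mono_set _ hU) h

section Error

variable {d : ℕ} {Ω : Set (E d)} (T : CoarseMesh Ω) {κ κt f : E d → ℝ} {κ₀ κ₁ : ℝ}
  {lam : Fin T.N → ℕ → ℝ} {φ : (i : Fin T.N) → ℕ → Pair (T.K i)} {l : Fin T.N → ℕ}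
  {ψ : ((i : Fin T.N) × Fin (l i)) → H10 Ω} {u ug : H10 Ω}

/-- The error is `s_i`-orthogonal to the auxiliary space, and satisfies the energy identity. -/
lemma error_orthogonal_and_energy (hd : 1 ≤ d) (hκm : AEMeasurable κ (volume.restrict Ω))
    (hκ₀ : 0 < κ₀) (hκ : ∀ᵐ x ∂(volume.restrict Ω), κ₀ ≤ κ x ∧ κ x ≤ κ₁)
    (hm : ∀ i, AEStronglyMeasurable κt (volume.restrict (T.K i)))
    (h0 : ∀ᵐ x ∂(volume.restrict Ω), 0 ≤ κt x)
    (hint : ∀ i, ∀ v ∈ H10 Ω, Integrable (fun x => κt x * fn v x ^ 2) (volume.restrict (T.K i)))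
    (hφ : ∀ i, IsEigenList κ κt Ω (T.K i) (lam i) (φ i))
    (hψ : T.IsGlobalBasis κ κt l φ ψ)
    (hu : ∀ v : H10 Ω, aForm κ Ω (gr u.1) (gr v.1) = ∫ x in Ω, f x * fn v.1 x)
    (hug : ug ∈ Submodule.span ℝ (range ψ))
    (hgal : ∀ v ∈ Submodule.span ℝ (range ψ),
      aForm κ Ω (gr ug.1) (gr v.1) = ∫ x in Ω, f x * fn v.1 x) :
    (∀ i, ∀ j < l i, sForm κt (T.K i) (fn (u - ug).1) (fn (φ i j)) = 0) ∧
      aForm κ Ω (gr (u - ug).1) (gr (u - ug).1) = ∫ x in Ω, f x * fn (u - ug).1 x := by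
  classical
  have hκabs : ∀ᵐ x ∂(volume.restrict Ω), |κ x| ≤ κ₁ := by
    filter_upwards [hκ] with x hx
    rw [abs_of_pos (hκ₀.trans_le hx.1)]
    exact hx.2
  obtain ⟨a, ha⟩ := exists_bilin_aForm hκm hκabs
  have hL : ∀ q : (i : Fin T.N) × Fin (l i), ∃ L : H10 Ω →ₗ[ℝ] ℝ, ∀ v : H10 Ω,
      L v = sForm κt (T.K q.1) (fn v.1) (fn (φ q.1 q.2)) := by
    rintro ⟨i, j⟩
    refine exists_linear_sForm (T.K_subset i) fun v hv => ?_
    have hle := Measure.restrict_mono_set (volume : Measure (E d)) (T.K_subset i)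
    refine integrable_weight_mul_mul (hm i) (ae_restrict_of_subset (T.K_subset i) h0)
      ((Lp.aestronglyMeasurable v.1).mono_measure hle) (Lp.aestronglyMeasurable (φ i j).1)
      (hint i v hv) ?_
    -- The eigenfunction is the restriction of an element of V, so it inherits finiteness of its
    -- weighted norm.
    obtain ⟨w, hw, h1, -⟩ := (hφ i).mem j
    refine (hint i w hw).congr ?_
    filter_upwards [h1] with x hx
    rw [hx]
  choose L hL using hL
  have hLs : ∀ q (v : H10 Ω), L q v = T.s κt (fn v.1) (T.ext φ q.1 q.2) := fun q v => by
    rw [hL, T.s_ext]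
  obtain ⟨R, hR0, hR⟩ := T.isBounded.exists_pos_norm_le
  -- κ ≥ κ₀ > 0 kills the gradient, and Poincaré then kills the function.
  have hdef : ∀ v : H10 Ω, a.domRestrict₁₂ (H10 Ω) (H10 Ω) v v = 0 → v = 0 := by
    intro v hv
    rw [LinearMap.domRestrict₁₂_apply, ha] at hv
    have h1 : κ₀ * ‖v.1.2‖ ^ 2 ≤ aForm κ Ω (gr v.1) (gr v.1) := by
      rw [norm_Lp_two_sq, ← integral_const_mul]
      refine integral_mono_ae
        (((Lp.memLp v.1.2).integrable_norm_pow two_ne_zero).const_mul κ₀)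
        (integrable_weight_inner hκm hκabs v.1 v.1) ?_
      filter_upwards [hκ] with x hx
      change κ₀ * ‖v.1.2 x‖ ^ 2 ≤ κ x * inner ℝ (v.1.2 x) (v.1.2 x)
      rw [real_inner_self_eq_norm_sq]
      exact mul_le_mul_of_nonneg_right hx.1 (sq_nonneg _)
    rw [hv] at h1
    have h2 : ‖v.1.2‖ ^ 2 ≤ 0 := by
      by_contra! h
      have := mul_pos hκ₀ h
      linarith
    have h3 : ‖v.1.2‖ = 0 := pow_eq_zero_iff two_ne_zero |>.1 (le_antisymm h2 (sq_nonneg _))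
    have h4 := norm_fst_le_of_mem_H10 hd hR0.le hR v.2
    rw [h3, mul_zero] at h4
    refine Subtype.ext (Prod.ext ?_ ?_)
    · exact norm_le_zero_iff.1 h4
    · exact norm_eq_zero.1 h3
  have hmain := constraint_error_eq_zero (a.domRestrict₁₂ (H10 Ω) (H10 Ω))
    (fun v w => by
      simp only [LinearMap.domRestrict₁₂_apply, ha, aForm]
      congr 1
      funext x
      rw [real_inner_comm])
    hdef L ψ
    (fun p q => by
      rw [hLs]
      convert (hψ p).1 q)
    (fun p v hv => by
      rw [LinearMap.domRestrict₁₂_apply, LinearMap.domRestrict₁₂_apply, ha, ha]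
      refine isMinOn_iff.1 (hψ p).2 v fun q => ?_
      rw [← hLs, hv])
    (fun v => ∫ x in Ω, f x * fn v.1 x) u ug
    (fun v => by
      rw [LinearMap.domRestrict₁₂_apply, ha]
      exact hu v)
    hug
    (fun v hv => by
      rw [LinearMap.domRestrict₁₂_apply, ha]
      exact hgal v hv)
  refine ⟨fun i j hj => ?_, ?_⟩
  · rw [← hL ⟨i, ⟨j, hj⟩⟩]
    exact hmain.1 _
  · rw [← hmain.2, LinearMap.domRestrict₁₂_apply, ha]

/-- The energy estimate for the error. -/
lemma error_energy_le (hd : 1 ≤ d) (hκm : AEMeasurable κ (volume.restrict Ω))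
    (hκ₀ : 0 < κ₀) (hκ : ∀ᵐ x ∂(volume.restrict Ω), κ₀ ≤ κ x ∧ κ x ≤ κ₁)
    (hf : AEMeasurable f (volume.restrict Ω))
    (hm : ∀ i, AEStronglyMeasurable κt (volume.restrict (T.K i)))
    (h0 : ∀ᵐ x ∂(volume.restrict Ω), 0 ≤ κt x)
    (hint : ∀ i, ∀ v ∈ H10 Ω, Integrable (fun x => κt x * fn v x ^ 2) (volume.restrict (T.K i)))
    (hφ : ∀ i, IsEigenList κ κt Ω (T.K i) (lam i) (φ i)) {e : Pair Ω} (he : e ∈ H10 Ω)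
    (horth : ∀ i, ∀ j < l i, sForm κt (T.K i) (fn e) (fn (φ i j)) = 0)
    (hen : aForm κ Ω (gr e) (gr e) = ∫ x in Ω, f x * fn e x) :
    ENNReal.ofReal (aNorm κ e) ≤
      ENNReal.ofReal (⨅ i, lam i (l i)) ^ (-(1 / 2) : ℝ) * invWeightNorm κt Ω f := by
  have hκabs : ∀ᵐ x ∂(volume.restrict Ω), |κ x| ≤ κ₁ := by
    filter_upwards [hκ] with x hx
    rw [abs_of_pos (hκ₀.trans_le hx.1)]
    exact hx.2
  have hκtm : AEMeasurable κt (volume.restrict Ω) := by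
    rw [T.restrict_eq hd]
    exact (aestronglyMeasurable_iUnion_iff.2 hm).aemeasurable
  have hintΩ := T.integrable_of_forall_K hd fun i => hint i e he
  have hsq : ∀ i, ∫ x in T.K i, κt x * fn e x ^ 2 = sForm κt (T.K i) (fn e) (fn e) := fun i => by
    rw [sForm]
    congr 1
    funext x
    ring
  refine ofReal_sqrt_le_rpow_mul (S := ∫ x in Ω, κt x * fn e x ^ 2)
    (integral_nonneg_of_ae (h0.mono fun x hx => mul_nonneg hx (sq_nonneg _))) ?_ fun hI => ?_
  · rw [T.integral_eq_sum hd fun i => hint i e he, aForm,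
      T.integral_eq_sum hd fun i => (integrable_weight_inner hκm hκabs e e).mono_measure
        (Measure.restrict_mono_set _ (T.K_subset i)), Finset.mul_sum]
    refine Finset.sum_le_sum fun i _ => ?_
    have hi0 := ae_restrict_of_subset (T.K_subset i) h0
    -- Numbering starts at 0, so `lam i (l i)` is the first eigenvalue not used in the auxiliary
    -- space.
    refine le_trans (mul_le_mul_of_nonneg_right
      (ciInf_le (Set.finite_range fun i => lam i (l i)).bddBelow i)
      (integral_nonneg_of_ae (hi0.mono fun x hx => mul_nonneg hx (sq_nonneg _)))) ?_
    rw [hsq i]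
    exact (hφ i).mul_sForm_le_aForm (T.K_subset i)
      (hκm.mono_measure (Measure.restrict_mono_set _ (T.K_subset i)))
      (ae_restrict_of_subset (T.K_subset i) hκabs)
      (ae_restrict_of_subset (T.K_subset i) (hκ.mono fun x hx => hκ₀.le.trans hx.1))
      (hm i) hi0 (hint i) he (horth i)
  · rw [hen]
    exact ofReal_integral_mul_le hκtm h0 hf (Lp.aestronglyMeasurable e.1).aemeasurable hintΩ hI

end Error

end CEM

theorem lemma4p1 (d : ℕ) (hd : 1 ≤ d) :
    ∃ C : ℝ, 0 < C ∧
      ∀ (Ω : Set (CEM.E d)) (_ : IsOpen Ω) (T : CEM.CoarseMesh Ω)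
        (κ : CEM.E d → ℝ) (_ : AEMeasurable κ (volume.restrict Ω))
        (κ₀ κ₁ : ℝ) (_ : 0 < κ₀) (_ : ∀ᵐ x ∂(volume.restrict Ω), κ₀ ≤ κ x ∧ κ x ≤ κ₁)
        (f : CEM.E d → ℝ) (_ : MemLp f 2 (volume.restrict Ω))
        -- the partition of unity and its gradients
        (χ : Fin T.Nc → CEM.E d → ℝ) (G : Fin T.Nc → CEM.E d → CEM.E d)
        (_ : T.IsMultiscalePU κ χ G ∨ T.IsBilinearPU χ G)
        -- eigenpairs of the local spectral problems, and the numbers of those used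
        (lam : Fin T.N → ℕ → ℝ) (φ : (i : Fin T.N) → ℕ → CEM.Pair (T.K i))
        (_ : ∀ i, CEM.IsEigenList κ (CEM.kappaTilde κ G) Ω (T.K i) (lam i) (φ i))
        (l : Fin T.N → ℕ)
        -- the global basis functions
        (ψ : ((i : Fin T.N) × Fin (l i)) → CEM.H10 Ω)
        (_ : T.IsGlobalBasis κ (CEM.kappaTilde κ G) l φ ψ)
        -- the weak solution and the Galerkin solution
        (u : CEM.H10 Ω)
        (_ : ∀ v : CEM.H10 Ω,
          CEM.aForm κ Ω (CEM.gr u.1) (CEM.gr v.1) = ∫ x in Ω, f x * CEM.fn v.1 x)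
        (uglo : CEM.H10 Ω) (_ : uglo ∈ Submodule.span ℝ (Set.range ψ))
        (_ : ∀ v ∈ Submodule.span ℝ (Set.range ψ),
          CEM.aForm κ Ω (CEM.gr uglo.1) (CEM.gr v.1) = ∫ x in Ω, f x * CEM.fn v.1 x),
        u - uglo ∈ T.kerProj (CEM.kappaTilde κ G) l φ ∧
        ENNReal.ofReal (CEM.aNorm κ (u - uglo).1) ≤
          ENNReal.ofReal (⨅ i, lam i (l i)) ^ (-(1 / 2) : ℝ) *
            CEM.invWeightNorm (CEM.kappaTilde κ G) Ω f ∧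
        (T.IsBilinearPU χ G →
          ENNReal.ofReal (CEM.aNorm κ (u - uglo).1) ≤
            ENNReal.ofReal (C * T.size) *
              ENNReal.ofReal (⨅ i, lam i (l i)) ^ (-(1 / 2) : ℝ) *
                CEM.invWeightNorm κ Ω f) := by 
  refine ⟨Real.sqrt (2 ^ d), by positivity, ?_⟩
  intro Ω _ T κ hκm κ₀ κ₁ hκ₀ hκ f hf χ G hPU lam φ hφ l ψ hψ u hu ug hug hgal
  -- If Ω is null the bounds on κ hold vacuously and κ₁ may be negative, hence the maximum with 0.
  have hκ' : ∀ᵐ x ∂(volume.restrict Ω), κ₀ ≤ κ x ∧ κ x ≤ max κ₁ 0 :=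
    hκ.mono fun x hx => ⟨hx.1, hx.2.trans (le_max_left _ _)⟩
  have hκmi : ∀ i, AEMeasurable κ (volume.restrict (T.K i)) := fun i =>
    hκm.mono_measure (Measure.restrict_mono_set _ (T.K_subset i))
  have hm : ∀ i, AEStronglyMeasurable (CEM.kappaTilde κ G) (volume.restrict (T.K i)) := fun i =>
    CEM.aestronglyMeasurable_kappaTilde T i (hκmi i) hPU
  have h0 : ∀ᵐ x ∂(volume.restrict Ω), 0 ≤ CEM.kappaTilde κ G x :=
    hκ.mono fun x hx => Finset.sum_nonneg fun j _ =>
      mul_nonneg (hκ₀.le.trans hx.1) (sq_nonneg _)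
  have hint : ∀ i, ∀ v ∈ CEM.H10 Ω, Integrable
      (fun x => CEM.kappaTilde κ G x * CEM.fn v x ^ 2) (volume.restrict (T.K i)) := fun i v hv =>
    CEM.integrable_kappaTilde_mul_sq T i hd (hκmi i) hκ₀ (le_max_right _ _)
      (CEM.ae_restrict_of_subset (T.K_subset i) hκ') hPU hv
  obtain ⟨horth, hen⟩ := CEM.error_orthogonal_and_energy T hd hκm hκ₀ hκ hm h0 hint hφ hψ hu hug
    hgal
  have hest := CEM.error_energy_le T hd hκm hκ₀ hκ hf.1.aemeasurable hm h0 hint hφ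
    (u - ug).2 horth hen
  refine ⟨?_, hest, fun hbil => ?_⟩
  · change T.proj (CEM.kappaTilde κ G) l φ (CEM.fn (u - ug).1) =ᵐ[volume.restrict Ω] 0
    refine Filter.Eventually.of_forall fun x => ?_
    refine Finset.sum_eq_zero fun i _ => Finset.sum_eq_zero fun j _ => ?_
    rw [CEM.sForm_congr (Filter.EventuallyEq.refl _ _) (T.ext_ae_eq i j), horth i j j.2, zero_div,
      zero_mul]
  · have hsize : 0 ≤ T.size := Real.iSup_nonneg fun i => Metric.diam_nonneg
    have hb : 0 ≤ Real.sqrt (2 ^ d) * T.size := by positivity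
    -- From κ ≤ 2^d H² κ̃ almost everywhere; the square root of 2^d is the constant C.
    have hle : CEM.invWeightNorm (CEM.kappaTilde κ G) Ω f ≤
        ENNReal.ofReal (Real.sqrt (2 ^ d) * T.size) * CEM.invWeightNorm κ Ω f := by
      refine CEM.invWeightNorm_le_mul hb ((T.ae_restrict_iff hd).2 fun i => ?_)
      have hG : ∀ᵐ x ∂(volume.restrict (T.K i)), ∀ j, G j x = gradient (T.nodal i j) x :=
        ae_all_iff.2 fun j => (hbil i j).2
      filter_upwards [hG, CEM.ae_restrict_of_subset (T.K_subset i) hκ,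
        ae_restrict_mem (T.isOpen_K i).measurableSet] with x h1 h2 hx
      have hpos : 0 < κ x := hκ₀.trans_le h2.1
      refine ⟨hpos, ?_⟩
      have h3 := mul_le_mul_of_nonneg_left (T.one_le_sum_norm_gradient_nodal i hd hx) hpos.le
      have h4 : CEM.kappaTilde κ G x = κ x * ∑ j, ‖gradient (T.nodal i j) x‖ ^ 2 := by
        simp only [CEM.kappaTilde, h1, Finset.mul_sum]
      rw [h4, mul_pow, Real.sq_sqrt (by positivity)]
      linarith
    refine hest.trans ((mul_le_mul_right hle _).trans (le_of_eq ?_))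
    ring
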